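/- Let $G$ be a connected finite bipartite graph with linearly ordered left and right vertex sets $V_1$ and $V_2$. Let $A_G=\{a_{ij}:=e_i+e_j \mid ij\in E(G)\}\subset\mathbb{Z}^{V_1\sqcup V_2}$, let $P_G=\mathrm{Conv}(A_G)$ be the edge polytope, and let $z_G$ be the $V_1\times V_2$ matrix whose $(i,j)$ entry is a variable $z_{ij}$ if $ij\in E(G)$ and $0$ otherwise. For a finite $A\subset\mathbb{Z}^N$ let $\nabla_A\subset\mathbb{C}^A$ be the Zariski closure of the set of those $z$ for which all partial derivatives of $f=\sum_{u\in A}z_u\alpha^u$ have a common zero $\alpha\in(\mathbb{C}^*)^N$. If $\nabla_A$ is a hypersurface, $A$ is called non-defective and $\Delta_A$ denotes a reduced defining polynomial of $\nabla_A$ (unique up to a nonzero constant); otherwise $\Delta_A:=1$. For a face $Q$ of $\mathrm{Conv}(A)$ (the set of points where some linear functional is maximal on $\mathrm{Conv}(A)$; $\mathrm{Conv}(A)$ itself is allowed) let $$i(Q,A)=[\mathbb{Z}^N\cap \mathrm{Lin}_{\mathbb{R}}(Q):\mathrm{Lin}_{\mathbb{Z}}(A\cap Q)],$$ and let $S(A)/Q$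 be the subsemigroup with $0$ of $\mathbb{Z}^N/(\mathbb{Z}^N\cap\mathrm{Lin}_{\mathbb{R}}(Q))$ generated by the image of $A$. For such a semigroup $S$, with generated group $\Xi(S)$, the subdiagram volume $u(S)$ is the volume of the closure of $\mathrm{Conv}(S)\setminus\mathrm{Conv}(S\setminus\{0\})$ in $\Xi(S)\otimes\mathbb{R}$, normalized so that a unimodular simplex of the lattice $\Xi(S)$ has volume $1$; $u(\{0\})=1$. It is a non-negative integer. The principal $A$-determinant is $$E_A=\prod_{Q}\Delta_{A\cap Q}^{\,i(Q,A)\,u(S(A)/Q)},$$ the product being over all faces $Q$ of $\mathrm{Conv}(A)$ with $A\cap Q$ non-defective. For $I\subset V_1$, $J\subset V_2$ let $G_{I\cup J}$ be the induced subgraph, $z_{I,J}$ the submatrix of $z_G$ with rows $I$ and columns $J$, and $Q_{I,J}$ the convex hull of the $a_{ij}$ with $ij\in E(G_{I\cup J})$. When $|I|=|J|$, say that $G_{I\cup J}$ satisfies $(*)$ if either $|I|=1$ and $G_{I\cup J}$ is connected, or $|I|>1$ and every non-empty proper subset $W\subsetneq I$ has more than $|W|$ neighbors in $G_{I\cup J}$.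 **Theorem.** Up to a nonzero constant factor, $$E_{A_G}(z)=\prod_{(I,J)}\det(z_{I,J})^{\,u(S(A_G)/Q_{I,J})},$$ where $(I,J)$ runs over the pairs of non-empty subsets $I\subset V_1$, $J\subset V_2$ such that $|I|=|J|$ and $G_{I\cup J}$ is connected and satisfies $(*)$. Moreover, if a face $Q$ of $P_G$ is not of the form $Q_{I,J}$ for such a pair, then $\Delta_{A_G\cap Q}=1$. -/

import Mathlib

open MvPolynomial

/-! ## The principal `A`-determinant of a finite configuration of lattice points -/

section Configuration

variable {σ : Type*}

/-- The inclusion `ℤ^σ → ℝ^σ`, as a `ℤ`-linear map. -/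
def latticeEmb (σ : Type*) : (σ → ℤ) →ₗ[ℤ] (σ → ℝ) :=
  ((Int.castAddHom ℝ).compLeft σ).toIntLinearMap

/-- The polytope `Conv(A) ⊆ ℝ^σ`. -/
def configPolytope (A : Finset (σ → ℤ)) : Set (σ → ℝ) :=
  convexHull ℝ (latticeEmb σ '' (A : Set (σ → ℤ)))

/-- `Q` is a face of `P`: the set of points of `P` at which some linear functional is maximal.
(The functional `0` gives the face `P` itself.) -/
def IsPolytopeFace (P Q : Set (σ → ℝ)) : Prop :=
  ∃ l : (σ → ℝ) →ₗ[ℝ] ℝ, Q = {x | x ∈ P ∧ ∀ y ∈ P, l y ≤ l x}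

/-- A finite configuration has only finitely many faces. -/
theorem finite_faces [Fintype σ] (A : Finset (σ → ℤ)) :
    {Q : Set (σ → ℝ) | IsPolytopeFace (configPolytope A) Q}.Finite := by
  have hfin : (latticeEmb σ '' (A : Set (σ → ℤ))).Finite := A.finite_toSet.image _
  have hP : IsCompact (configPolytope A) := hfin.isCompact_convexHull ℝ
  have hexp : ∀ Q, IsPolytopeFace (configPolytope A) Q → IsExposed ℝ (configPolytope A) Q := by
    rintro Q ⟨l, hl⟩ -
    exact ⟨LinearMap.toContinuousLinearMap l, by simpa using hl⟩
  refine Set.Finite.of_finite_image (f := fun Q => Set.extremePoints ℝ Q)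
    (hfin.finite_subsets.subset ?_) ?_
  · rintro _ ⟨Q, hQ, rfl⟩
    exact ((hexp Q hQ).isExtreme.extremePoints_subset_extremePoints).trans
      extremePoints_convexHull_subset
  · intro Q hQ Q' hQ' h
    have key : ∀ R, IsPolytopeFace (configPolytope A) R →
        closure (convexHull ℝ (Set.extremePoints ℝ R)) = R := fun R hR =>
      closure_convexHull_extremePoints ((hexp R hR).isCompact hP)
        ((hexp R hR).convex (convex_convexHull ℝ _))
    rw [← key Q hQ, ← key Q' hQ']
    exact congrArg (fun E => closure (convexHull ℝ E)) h

/-- The set of all faces of `Conv(A)`, including `Conv(A)` itself. -/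
noncomputable def configFaces [Fintype σ] (A : Finset (σ → ℤ)) : Finset (Set (σ → ℝ)) :=
  (finite_faces A).toFinset

open scoped Classical in
/-- `A ∩ Q`: the elements of `A` that lie in `Q`. -/
noncomputable def configInter (A : Finset (σ → ℤ)) (Q : Set (σ → ℝ)) : Finset (σ → ℤ) :=
  A.filter fun u => latticeEmb σ u ∈ Q

theorem configInter_subset (A : Finset (σ → ℤ)) (Q : Set (σ → ℝ)) : configInter A Q ⊆ A := by
  classical exact Finset.filter_subset _ _

open scoped Classical in
/-- The partial derivative `∂f/∂α_i` at the point `α` of the Laurent polynomial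
`f(α; z) = ∑_{u ∈ A} z_u α^u`, namely `∑_{u ∈ A} z_u u_i α^(u - e_i)`. -/
noncomputable def laurentPartial [Fintype σ] (A : Finset (σ → ℤ)) (z : A → ℂ) (i : σ)
    (α : σ → ℂ) : ℂ :=
  ∑ u : A, z u * ((u : σ → ℤ) i : ℂ) * ∏ j, α j ^ ((u : σ → ℤ) j - (Pi.single i 1 : σ → ℤ) j)

/-- The coefficient vectors `z ∈ ℂ^A` for which all partial derivatives of `f(·; z)` vanish at
a common point of the torus `(ℂ^*)^σ`. -/
def singularCoefficients [Fintype σ] (A : Finset (σ → ℤ)) : Set (A → ℂ) :=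
  {z | ∃ α : σ → ℂ, (∀ i, α i ≠ 0) ∧ ∀ i, laurentPartial A z i α = 0}

/-- The `A`-discriminant variety: the Zariski closure of `singularCoefficients A` in `ℂ^A`. -/
def discriminantVariety [Fintype σ] (A : Finset (σ → ℤ)) : Set (A → ℂ) :=
  zeroLocus ℂ (vanishingIdeal ℂ (singularCoefficients A))

/-- `p` is a reduced defining polynomial of the hypersurface `V`. It is determined by `V` up to a
nonzero constant factor. -/
def IsReducedEquation {τ : Type*} (V : Set (τ → ℂ)) (p : MvPolynomial τ ℂ) : Prop :=
  Squarefree p ∧ ¬ IsUnit p ∧ V = {x | eval x p = 0}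

/-- `A` is non-defective: the `A`-discriminant variety is a hypersurface. -/
def IsNonDefective [Fintype σ] (A : Finset (σ → ℤ)) : Prop :=
  ∃ p : MvPolynomial A ℂ, IsReducedEquation (discriminantVariety A) p

open scoped Classical in
/-- The `A`-discriminant `Δ_A`: a reduced defining polynomial of the `A`-discriminant variety
if that is a hypersurface, and `1` otherwise. -/
noncomputable def aDiscriminant [Fintype σ] (A : Finset (σ → ℤ)) : MvPolynomial A ℂ :=
  if h : IsNonDefective A then h.choose else 1

/-- `ℤ^σ ∩ Lin_ℝ(Q)`. -/
def faceLattice (Q : Set (σ → ℝ)) : Submodule ℤ (σ → ℤ) :=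
  ((Submodule.span ℝ Q).restrictScalars ℤ).comap (latticeEmb σ)

/-- The index `i(Q, A) = [ℤ^σ ∩ Lin_ℝ(Q) : Lin_ℤ(A ∩ Q)]`. -/
noncomputable def faceIndex (A : Finset (σ → ℤ)) (Q : Set (σ → ℝ)) : ℕ :=
  (Submodule.span ℤ (configInter A Q : Set (σ → ℤ))).toAddSubgroup.relIndex
    (faceLattice Q).toAddSubgroup

/-- The lattice `ℤ^σ / (ℤ^σ ∩ Lin_ℝ(Q))`. -/
abbrev FaceQuotient (Q : Set (σ → ℝ)) : Type _ := (σ → ℤ) ⧸ faceLattice Q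

instance faceQuotient_isTorsionFree (Q : Set (σ → ℝ)) : Module.IsTorsionFree ℤ (FaceQuotient Q) := by
  refine Module.IsTorsionFree.of_smul_eq_zero fun n x h => ?_
  induction x using Submodule.Quotient.induction_on with
  | H v =>
    rw [← Submodule.Quotient.mk_smul, Submodule.Quotient.mk_eq_zero] at h
    by_cases hn : n = 0
    · exact Or.inl hn
    · refine Or.inr ((Submodule.Quotient.mk_eq_zero _).2 ?_)
      have h1 : latticeEmb σ (n • v) ∈ Submodule.span ℝ Q := h
      have h2 : latticeEmb σ v = (n : ℝ)⁻¹ • latticeEmb σ (n • v) := by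
        have hn' : (n : ℝ) ≠ 0 := by exact_mod_cast hn
        rw [map_smul, ← Int.cast_smul_eq_zsmul ℝ n, smul_smul, inv_mul_cancel₀ hn', one_smul]
      change latticeEmb σ v ∈ Submodule.span ℝ Q
      rw [h2]
      exact Submodule.smul_mem _ _ h1

instance faceQuotient_free [Fintype σ] (Q : Set (σ → ℝ)) : Module.Free ℤ (FaceQuotient Q) :=
  Module.free_of_finite_type_torsion_free'

/-- The semigroup `S(A)/Q`: the subsemigroup of `ℤ^σ / (ℤ^σ ∩ Lin_ℝ(Q))` generated by the classes
of the elements of `A`, and `0`. -/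
def semigroupQuotient (A : Finset (σ → ℤ)) (Q : Set (σ → ℝ)) : AddSubmonoid (FaceQuotient Q) :=
  AddSubmonoid.closure ((faceLattice Q).mkQ '' (A : Set (σ → ℤ)))

end Configuration

/-! ## Subdiagram volumes -/

section Subdiagram

variable {M : Type*} [AddCommGroup M] [Module.Free ℤ M] [Module.Finite ℤ M]

/-- The group `Ξ(S)` generated by the semigroup `S`. -/
abbrev groupCompletion (S : AddSubmonoid M) : Submodule ℤ M := Submodule.span ℤ (S : Set M)

/-- The elements of `S` as points of `Ξ(S) ⊗ ℝ`, in the coordinates of a `ℤ`-basis of `Ξ(S)`.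
In these coordinates the lattice `Ξ(S)` is `ℤ^r`, where `r` is its rank. -/
noncomputable def semigroupPoints (S : AddSubmonoid M) :
    Set (Fin (Module.finrank ℤ (groupCompletion S)) → ℝ) :=
  {x | ∃ s : groupCompletion S, (s : M) ∈ S ∧
    x = fun i => ((Module.finBasis ℤ (groupCompletion S)).repr s i : ℝ)}

/-- `K_-(S)`: the closure of `K(S) \ K_+(S)`, where `K(S)` and `K_+(S)` are the convex hulls of
`S` and `S \ {0}`. -/
noncomputable def subdiagramPart (S : AddSubmonoid M) :
    Set (Fin (Module.finrank ℤ (groupCompletion S)) → ℝ) :=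
  closure (convexHull ℝ (semigroupPoints S) \ convexHull ℝ (semigroupPoints S \ {0}))

/-- The normalized volume of `K_-(S)`: the Lebesgue measure for which `Ξ(S)` has covolume `1`,
multiplied by `r!`, so that a unimodular simplex has volume `1`. For `S = {0}` it is `1`. -/
noncomputable def subdiagramVolumeReal (S : AddSubmonoid M) : ℝ :=
  (Module.finrank ℤ (groupCompletion S)).factorial *
    (MeasureTheory.volume (subdiagramPart S)).toReal

/-- The subdiagram volume `u(S)`. The normalized volume of `K_-(S)` is an integer for the
semigroups considered, because `K_-(S)` is a union of lattice polytopes; the rounding only turns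
that real number into an element of `ℕ`. -/
noncomputable def subdiagramVolume (S : AddSubmonoid M) : ℕ := ⌊subdiagramVolumeReal S⌋₊

end Subdiagram

section PrincipalDeterminant

variable {σ : Type*} [Fintype σ]

/-- The multiplicity `m_Q = i(Q, A) · u(S(A)/Q)`. -/
noncomputable def faceMultiplicity (A : Finset (σ → ℤ)) (Q : Set (σ → ℝ)) : ℕ :=
  faceIndex A Q * subdiagramVolume (semigroupQuotient A Q)

/-- `Δ_{A ∩ Q}`, as a polynomial in the variables `z_u`, `u ∈ A`. -/
noncomputable def faceDiscriminant (A : Finset (σ → ℤ)) (Q : Set (σ → ℝ)) : MvPolynomial A ℂ :=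
  rename (fun u : configInter A Q => (⟨u, configInter_subset A Q u.2⟩ : A))
    (aDiscriminant (configInter A Q))

open scoped Classical in
/-- The principal `A`-determinant `E_A`: the product of `Δ_{A ∩ Q} ^ m_Q` over the faces `Q` of
`Conv(A)` for which `A ∩ Q` is non-defective. As the discriminants are, it is determined up to
a nonzero constant factor. -/
noncomputable def principalADeterminant (A : Finset (σ → ℤ)) : MvPolynomial A ℂ :=
  ∏ Q ∈ (configFaces A).filter (fun Q => IsNonDefective (configInter A Q)),
    faceDiscriminant A Q ^ faceMultiplicity A Q

end PrincipalDeterminant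

/-! ## Edge polytopes of bipartite graphs -/

section Bipartite

variable {ι κ : Type*} [Fintype ι] [Fintype κ] [LinearOrder ι] [LinearOrder κ]

/-- `a_{ij} = e_i + e_j`. -/
def edgeVector (i : ι) (j : κ) : ι ⊕ κ → ℤ := Pi.single (Sum.inl i) 1 + Pi.single (Sum.inr j) 1

open scoped Classical in
/-- The configuration `A_G` of a bipartite graph `G` with left vertex set `ι` and right vertex
set `κ`. -/
noncomputable def edgeConfig (G : SimpleGraph (ι ⊕ κ)) : Finset (ι ⊕ κ → ℤ) :=
  (Finset.univ.filter fun e : ι × κ => G.Adj (Sum.inl e.1) (Sum.inr e.2)).image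
    fun e => edgeVector e.1 e.2

theorem edgeVector_mem_edgeConfig {G : SimpleGraph (ι ⊕ κ)} {i : ι} {j : κ}
    (h : G.Adj (Sum.inl i) (Sum.inr j)) : edgeVector i j ∈ edgeConfig G :=
  Finset.mem_image.2 ⟨(i, j), by simpa using h, rfl⟩

open scoped Classical in
/-- The Edmonds matrix `z_G`: the entry `z_{ij}` is the variable belonging to the edge `ij`, and it
is `0` where there is no edge. -/
noncomputable def edmondsMatrix (G : SimpleGraph (ι ⊕ κ)) :
    Matrix ι κ (MvPolynomial (edgeConfig G) ℂ) :=
  fun i j => if h : G.Adj (Sum.inl i) (Sum.inr j) then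
    X ⟨edgeVector i j, edgeVector_mem_edgeConfig h⟩ else 0

/-- `det z_{I,J}` for `|I| = |J|`, the rows in `I` and the columns in `J` being taken in increasing
order. (It is only used for `|I| = |J|`.) -/
noncomputable def edmondsMinor (G : SimpleGraph (ι ⊕ κ)) (I : Finset ι) (J : Finset κ) :
    MvPolynomial (edgeConfig G) ℂ :=
  if h : J.card = I.card then
    ((edmondsMatrix G).submatrix (I.orderEmbOfFin rfl) (J.orderEmbOfFin h)).det
  else 0

/-- The induced subgraph `G_{I ∪ J}` is connected. -/
def IsConnectedOn (G : SimpleGraph (ι ⊕ κ)) (I : Finset ι) (J : Finset κ) : Prop :=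
  (G.induce {v | Sum.elim (· ∈ I) (· ∈ J) v}).Connected

open scoped Classical in
/-- The neighborhood `N(G_{I ∪ J}; W)` of a subset `W` of `I`. -/
noncomputable def neighborsIn (G : SimpleGraph (ι ⊕ κ)) (J : Finset κ) (W : Finset ι) : Finset κ :=
  J.filter fun j => ∃ i ∈ W, G.Adj (Sum.inl i) (Sum.inr j)

/-- The condition `(*)` for the graph `G_{I ∪ J}`. -/
def ConditionStar (G : SimpleGraph (ι ⊕ κ)) (I : Finset ι) (J : Finset κ) : Prop :=
  (I.card = 1 ∧ IsConnectedOn G I J) ∨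
    (1 < I.card ∧ ∀ W : Finset ι, W.Nonempty → W ⊂ I → W.card < (neighborsIn G J W).card)

open scoped Classical in
/-- The pairs `(I, J)` of non-empty sets with `|I| = |J|` for which `G_{I ∪ J}` is connected and
satisfies `(*)`. -/
noncomputable def starPairs (G : SimpleGraph (ι ⊕ κ)) : Finset (Finset ι × Finset κ) :=
  Finset.univ.filter fun p => p.1.Nonempty ∧ p.2.Nonempty ∧ p.1.card = p.2.card ∧
    IsConnectedOn G p.1 p.2 ∧ ConditionStar G p.1 p.2

/-- `Q_{I,J}`: the convex hull of the `a_{ij}` with `ij` an edge of `G_{I ∪ J}`. -/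
def edgeFace (G : SimpleGraph (ι ⊕ κ)) (I : Finset ι) (J : Finset κ) : Set (ι ⊕ κ → ℝ) :=
  convexHull ℝ {x | ∃ i ∈ I, ∃ j ∈ J, G.Adj (Sum.inl i) (Sum.inr j) ∧
    x = latticeEmb (ι ⊕ κ) (edgeVector i j)}

end Bipartite

/-! ## Reduced equations -/

section ReducedEquation

variable {τ : Type*}

/-! The polynomial attached to a set `B` of edges is the bilinear form `∑ z_ij x_i y_j`. Its partial
derivatives have a common zero in the torus exactly when the coefficient matrix has a left and a
right kernel vector without zero entries (`mem_singularCoefficients_iff`). From this it follows that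
`B` is non-defective exactly when its graph has the property `StrongHall`, and that the discriminant
is then a determinant.

Necessity (`IsReducedEquation.strongHall`): if all entries of some rows lie in equally many columns,
the corresponding minor vanishes on the singular vectors, so the discriminant divides it; likewise
with rows and columns exchanged. A failure of strong Hall yields, for each vertex of one side, a
non-zero minor of this kind avoiding that vertex. The discriminant then has degree zero at every
vertex of that side, so it is constant, which is impossible.

Sufficiency (`StrongHall.isReducedEquation`): strong Hall makes the graph connected and puts every
edge into a perfect matching. The determinant has degree one at each vertex and involves every edge
variable, so in a factorization adjacent vertices belong to the same factor, and by connectedness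
the other factor is constant. At a point of `det = 0` where no cofactor vanishes, a row and a column
of the adjugate are kernel vectors without zero entries. Since the determinant divides no cofactor,
these points are dense in `det = 0`.

Faces: on the graph of a non-defective face the maximizing functional is constant on the edges,
hence by connectedness on the vertices of each side. So the face contains every edge of the induced
subgraph and equals some `Q_{I,J}`. The same colouring argument modulo the lattice of the edge
vectors shows that the index is `1` (`faceIndex_edgeFace`), which leaves only the subdiagram volume
in the exponent. -/

theorem IsReducedEquation.dvd_of_mem_vanishingIdeal [Finite τ] {V : Set (τ → ℂ)}
    {p q : MvPolynomial τ ℂ} (hp : IsReducedEquation V p) (hq : q ∈ vanishingIdeal ℂ V) :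
    p ∣ q := by
  have hV : V = zeroLocus ℂ (Ideal.span {p}) := by
    rw [zeroLocus_span, hp.2.2]
    ext x
    simp [aeval_eq_eval]
  -- By the Nullstellensatz a power of `q` lies in `(p)`; a squarefree `p` then divides `q` itself.
  rw [hV, vanishingIdeal_zeroLocus_eq_radical] at hq
  obtain ⟨n, hn⟩ := Ideal.mem_radical_iff.1 hq
  exact hp.1.isRadical n q (Ideal.mem_span_singleton.1 hn)

theorem IsReducedEquation.mem_vanishingIdeal {V : Set (τ → ℂ)} {p : MvPolynomial τ ℂ}
    (hp : IsReducedEquation V p) : p ∈ vanishingIdeal ℂ V := by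
  rw [mem_vanishingIdeal_iff, hp.2.2]
  intro x hx
  simpa [aeval_eq_eval] using hx

theorem IsReducedEquation.associated [Finite τ] {V : Set (τ → ℂ)} {p q : MvPolynomial τ ℂ}
    (hp : IsReducedEquation V p) (hq : IsReducedEquation V q) : Associated p q :=
  associated_of_dvd_dvd (hp.dvd_of_mem_vanishingIdeal hq.mem_vanishingIdeal)
    (hq.dvd_of_mem_vanishingIdeal hp.mem_vanishingIdeal)

variable {σ : Type*} [Fintype σ]

theorem IsReducedEquation.dvd_of_vanishes {A : Finset (σ → ℤ)} {p q : MvPolynomial A ℂ}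
    (hp : IsReducedEquation (discriminantVariety A) p)
    (hq : ∀ z ∈ singularCoefficients A, eval z q = 0) : p ∣ q :=
  hp.dvd_of_mem_vanishingIdeal <| le_vanishingIdeal_zeroLocus _ <|
    mem_vanishingIdeal_iff.2 fun z hz => by simpa [aeval_eq_eval] using hq z hz

/-- A prime polynomial which generates the ideal of the singular coefficient vectors is an equation
of the discriminant variety. -/
theorem isReducedEquation_of_prime {A : Finset (σ → ℤ)} {p : MvPolynomial A ℂ} (hp : Prime p)
    (h0 : ∀ z ∈ singularCoefficients A, eval z p = 0)
    (h : ∀ q : MvPolynomial A ℂ, (∀ z ∈ singularCoefficients A, eval z q = 0) → p ∣ q) :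
    IsReducedEquation (discriminantVariety A) p := by
  refine ⟨hp.irreducible.squarefree, hp.not_isUnit, ?_⟩
  have : vanishingIdeal ℂ (singularCoefficients A) = Ideal.span {p} := by
    ext q
    rw [Ideal.mem_span_singleton, mem_vanishingIdeal_iff]
    refine ⟨fun hq => h q fun z hz => by simpa [aeval_eq_eval] using hq z hz, ?_⟩
    rintro ⟨r, rfl⟩ z hz
    simp [aeval_eq_eval, h0 z hz]
  rw [discriminantVariety, this, zeroLocus_span]
  ext x
  simp [aeval_eq_eval]

end ReducedEquation

/-! ## The degree of a polynomial at a coordinate -/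

section VertexDegree

variable {σ : Type*} {B : Finset (σ → ℤ)}

/-- The ring homomorphism which multiplies the variable `z_u` by `t ^ u_v`. -/
noncomputable def gradeHom (B : Finset (σ → ℤ)) (v : σ) :
    MvPolynomial B ℂ →+* Polynomial (MvPolynomial B ℂ) :=
  eval₂Hom (Polynomial.C.comp C)
    fun u => Polynomial.C (X u) * Polynomial.X ^ ((u : σ → ℤ) v).toNat

/-- The degree of `p` in the variables `z_u`, the variable `z_u` having degree `u_v`. -/
noncomputable def vertexDegree (v : σ) (p : MvPolynomial B ℂ) : ℕ := (gradeHom B v p).natDegree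

@[simp]
theorem gradeHom_X (v : σ) (u : B) :
    gradeHom B v (X u) = Polynomial.C (X u) * Polynomial.X ^ ((u : σ → ℤ) v).toNat := by
  simp [gradeHom]

/-- Setting `t = 1` undoes the grading, so `gradeHom` is injective and degrees are additive on
products. -/
theorem eval_one_gradeHom (v : σ) (p : MvPolynomial B ℂ) :
    Polynomial.eval 1 (gradeHom B v p) = p := by
  have : (Polynomial.evalRingHom 1).comp (gradeHom B v) = RingHom.id (MvPolynomial B ℂ) := by
    ext <;> simp [gradeHom]
  exact RingHom.congr_fun this p

theorem gradeHom_ne_zero {v : σ} {p : MvPolynomial B ℂ} (hp : p ≠ 0) : gradeHom B v p ≠ 0 := by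
  intro h
  apply hp
  rw [← eval_one_gradeHom v p, h, Polynomial.eval_zero]

theorem vertexDegree_mul (v : σ) {p q : MvPolynomial B ℂ} (hp : p ≠ 0) (hq : q ≠ 0) :
    vertexDegree v (p * q) = vertexDegree v p + vertexDegree v q := by
  rw [vertexDegree, map_mul, Polynomial.natDegree_mul (gradeHom_ne_zero hp) (gradeHom_ne_zero hq)]
  rfl

theorem vertexDegree_le_of_dvd (v : σ) {p q : MvPolynomial B ℂ} (hq : q ≠ 0) (h : p ∣ q) :
    vertexDegree v p ≤ vertexDegree v q := by
  obtain ⟨r, rfl⟩ := h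
  rw [vertexDegree_mul v (left_ne_zero_of_mul hq) (right_ne_zero_of_mul hq)]
  exact Nat.le_add_right _ _

/-- In degree zero the substitutions `t = 1` and `t = 0` agree. The first returns `p`, the second
kills every variable of positive weight. -/
theorem notMem_vars_of_vertexDegree_eq_zero {v : σ} {p : MvPolynomial B ℂ}
    (h : vertexDegree v p = 0) {u : B} (hu : 0 < (u : σ → ℤ) v) : u ∉ p.vars := by
  have h1 := eval_one_gradeHom v p
  rw [Polynomial.eq_C_of_natDegree_eq_zero h, Polynomial.eval_C] at h1
  have h2 : Polynomial.eval 0 (gradeHom B v p) = p := by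
    rw [Polynomial.eq_C_of_natDegree_eq_zero h, Polynomial.eval_C, h1]
  have h3 : (Polynomial.evalRingHom 0).comp (gradeHom B v) =
      (bind₁ fun u : B => X u * 0 ^ ((u : σ → ℤ) v).toNat : _ →ₐ[ℂ] MvPolynomial B ℂ) := by
    ext <;> simp [gradeHom]
  have h4 : bind₁ (fun u : B => X u * 0 ^ ((u : σ → ℤ) v).toNat) p = p :=
    (RingHom.congr_fun h3 p).symm.trans h2
  intro hmem
  classical
  rw [← h4] at hmem
  obtain ⟨w, -, hw⟩ := Finset.mem_biUnion.1 (vars_bind₁ _ _ hmem)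
  by_cases hw0 : ((w : σ → ℤ) v).toNat = 0
  · rw [hw0, pow_zero, mul_one, vars_X, Finset.mem_singleton] at hw
    subst hw
    omega
  · rw [zero_pow hw0, mul_zero, vars_0] at hw
    exact absurd hw (Finset.notMem_empty _)

theorem isUnit_of_vars_eq_empty {p : MvPolynomial B ℂ} (hp : p ≠ 0) (h : ∀ u, u ∉ p.vars) :
    IsUnit p := by
  classical
  have h1 : p = C (coeff 0 p) := by
    ext m
    rw [coeff_C]
    split_ifs with hm
    · rw [hm]
    · obtain ⟨u, hu⟩ : ∃ u, m u ≠ 0 := by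
        by_contra! hcon
        exact hm (Finsupp.ext fun u => (hcon u).symm)
      by_contra hc
      exact h u ((mem_vars_iff_mem_support u).2 ⟨m, mem_support_iff.2 hc, Finsupp.mem_support_iff.2 hu⟩)
  rw [h1]
  refine IsUnit.map C (isUnit_iff_ne_zero.2 fun h0 => hp ?_)
  rw [h1, h0, C_0]

theorem eval_congr_of_notMem_vars {p : MvPolynomial B ℂ} {u : B} (hu : u ∉ p.vars)
    {x y : B → ℂ} (h : ∀ w, w ≠ u → x w = y w) : eval x p = eval y p := by
  refine eval₂Hom_congr' rfl (fun w hw _ => h w ?_) rfl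
  rintro rfl
  exact hu hw

end VertexDegree

/-! ## Configurations of edge vectors -/

section EdgeVector

variable {ι κ : Type*} [LinearOrder ι] [LinearOrder κ]

@[simp]
theorem edgeVector_inl (i i' : ι) (j : κ) :
    edgeVector i j (Sum.inl i') = if i' = i then 1 else 0 := by
  simp [edgeVector, Pi.single_apply]

@[simp]
theorem edgeVector_inr (i : ι) (j j' : κ) :
    edgeVector i j (Sum.inr j') = if j' = j then 1 else 0 := by
  simp [edgeVector, Pi.single_apply]

theorem edgeVector_inj {i i' : ι} {j j' : κ} :
    edgeVector i j = edgeVector i' j' ↔ i = i' ∧ j = j' := by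
  refine ⟨fun h => ⟨?_, ?_⟩, fun h => by rw [h.1, h.2]⟩
  · simpa using congrFun h (Sum.inl i)
  · simpa using congrFun h (Sum.inr j)

/-- Every element of `B` is of the form `e_i + e_j`. -/
def IsEdgeConfig (B : Finset (ι ⊕ κ → ℤ)) : Prop := ∀ u ∈ B, ∃ i j, edgeVector i j = u

open scoped Classical in
/-- The matrix whose `(i, j)` entry is the variable of `e_i + e_j`, if that belongs to `B`. -/
noncomputable def genericMatrix (B : Finset (ι ⊕ κ → ℤ)) : Matrix ι κ (MvPolynomial B ℂ) :=
  fun i j => if h : edgeVector i j ∈ B then X ⟨edgeVector i j, h⟩ else 0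

open scoped Classical in
/-- The value of the generic matrix at a coefficient vector. -/
noncomputable def coeffMatrix {B : Finset (ι ⊕ κ → ℤ)} (z : B → ℂ) : Matrix ι κ ℂ :=
  fun i j => if h : edgeVector i j ∈ B then z ⟨edgeVector i j, h⟩ else 0

variable {B : Finset (ι ⊕ κ → ℤ)}

theorem coeffMatrix_of_notMem {z : B → ℂ} {i : ι} {j : κ} (h : edgeVector i j ∉ B) :
    coeffMatrix z i j = 0 := dif_neg h

theorem coeffMatrix_of_mem {z : B → ℂ} {i : ι} {j : κ} (h : edgeVector i j ∈ B) :
    coeffMatrix z i j = z ⟨_, h⟩ := dif_pos h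

theorem genericMatrix_of_notMem {i : ι} {j : κ} (h : edgeVector i j ∉ B) :
    genericMatrix B i j = 0 := dif_neg h

theorem genericMatrix_of_mem {i : ι} {j : κ} (h : edgeVector i j ∈ B) :
    genericMatrix B i j = X ⟨_, h⟩ := dif_pos h

theorem eval_genericMatrix (z : B → ℂ) (i : ι) (j : κ) :
    eval z (genericMatrix B i j) = coeffMatrix z i j := by
  by_cases h : edgeVector i j ∈ B
  · rw [genericMatrix_of_mem h, coeffMatrix_of_mem h, eval_X]
  · rw [genericMatrix_of_notMem h, coeffMatrix_of_notMem h, map_zero]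

theorem map_eval_genericMatrix_submatrix (z : B → ℂ) {m n : Type*} (f : m → ι) (g : n → κ) :
    ((genericMatrix B).submatrix f g).map (eval z) = (coeffMatrix z).submatrix f g := by
  ext a b
  simp [eval_genericMatrix]

theorem prod_zpow_single {σ : Type*} [Fintype σ] [DecidableEq σ] (α : σ → ℂ) (w : σ) :
    ∏ v, α v ^ (Pi.single w 1 : σ → ℤ) v = α w := by
  rw [Finset.prod_eq_single w]
  · simp
  · intro v _ hv
    simp [hv]
  · simp

variable [Fintype ι] [Fintype κ]

/-- Summing over all pairs, with zero at non-edges, turns the partial derivatives into matrix-vector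
products. -/
theorem IsEdgeConfig.sum_eq {M : Type*} [AddCommMonoid M] (hB : IsEdgeConfig B) (F : B → M)
    (F' : ι → κ → M) (hF : ∀ i j (h : edgeVector i j ∈ B), F' i j = F ⟨_, h⟩)
    (hF0 : ∀ i j, edgeVector i j ∉ B → F' i j = 0) :
    ∑ u, F u = ∑ i, ∑ j, F' i j := by
  have h1 : ∀ i j, F' i j = ∑ u : B, if edgeVector i j = u.1 then F u else 0 := by
    intro i j
    by_cases h : edgeVector i j ∈ B
    · rw [hF i j h, Finset.sum_eq_single ⟨_, h⟩]
      · simp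
      · intro u _ hu
        rw [if_neg fun he => hu (Subtype.ext he.symm)]
      · simp
    · rw [hF0 i j h, Finset.sum_eq_zero]
      intro u _
      rw [if_neg]
      intro he
      exact h (he ▸ u.2)
  have h2 : ∀ u : B, F u = ∑ e : ι × κ, if edgeVector e.1 e.2 = u.1 then F u else 0 := by
    rintro ⟨u, hu⟩
    obtain ⟨i, j, rfl⟩ := hB u hu
    rw [Finset.sum_eq_single (i, j)]
    · simp
    · rintro ⟨i', j'⟩ _ he
      rw [if_neg]
      intro h
      exact he (Prod.ext_iff.2 (edgeVector_inj.1 h))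
    · simp
  simp_rw [h1]
  rw [← Fintype.sum_prod_type' (f := fun i j => ∑ u : B, if edgeVector i j = u.1 then F u else 0),
    Finset.sum_comm]
  exact Finset.sum_congr rfl fun u _ => h2 u

theorem laurentPartial_inl (hB : IsEdgeConfig B) (z : B → ℂ) (i : ι) (α : ι ⊕ κ → ℂ) :
    laurentPartial B z (Sum.inl i) α = (coeffMatrix z).mulVec (α ∘ Sum.inr) i := by
  classical
  rw [laurentPartial, hB.sum_eq _
    fun i' j => if i' = i then coeffMatrix z i j * α (Sum.inr j) else 0]
  · rw [Finset.sum_eq_single i]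
    · simp [Matrix.mulVec, dotProduct]
    · intro i' _ hi
      simp [hi]
    · simp
  · intro i' j h
    by_cases hi : i' = i
    · subst hi
      -- Differentiating `x_i y_j` by `x_i` leaves the exponent vector `e_j`.
      have h1 : ∀ v, edgeVector i' j v - (Pi.single (Sum.inl i') 1 : ι ⊕ κ → ℤ) v
          = (Pi.single (Sum.inr j) 1 : ι ⊕ κ → ℤ) v := by
        intro v
        simp [edgeVector]
      rw [if_pos rfl, coeffMatrix_of_mem h]
      dsimp only
      rw [edgeVector_inl, if_pos rfl, Int.cast_one, mul_one]
      congr 1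
      rw [← prod_zpow_single α (Sum.inr j)]
      refine Finset.prod_congr rfl fun v _ => congrArg (α v ^ ·) ?_
      convert (h1 v).symm
    · simp [hi, Ne.symm hi]
  · intro i' j h
    split_ifs with hi
    · subst hi
      rw [coeffMatrix_of_notMem h, zero_mul]
    · rfl

theorem laurentPartial_inr (hB : IsEdgeConfig B) (z : B → ℂ) (j : κ) (α : ι ⊕ κ → ℂ) :
    laurentPartial B z (Sum.inr j) α = (coeffMatrix z).vecMul (α ∘ Sum.inl) j := by
  classical
  rw [laurentPartial, hB.sum_eq _
    fun i j' => if j' = j then α (Sum.inl i) * coeffMatrix z i j else 0]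
  · simp [Matrix.vecMul, dotProduct]
  · intro i j' h
    by_cases hj : j' = j
    · subst hj
      have h1 : ∀ v, edgeVector i j' v - (Pi.single (Sum.inr j') 1 : ι ⊕ κ → ℤ) v
          = (Pi.single (Sum.inl i) 1 : ι ⊕ κ → ℤ) v := by
        intro v
        simp [edgeVector]
      rw [if_pos rfl, coeffMatrix_of_mem h]
      dsimp only
      rw [edgeVector_inr, if_pos rfl, Int.cast_one, mul_one, mul_comm]
      congr 1
      rw [← prod_zpow_single α (Sum.inl i)]
      refine Finset.prod_congr rfl fun v _ => congrArg (α v ^ ·) ?_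
      convert (h1 v).symm
    · simp [hj, Ne.symm hj]
  · intro i j' h
    split_ifs with hj
    · subst hj
      rw [coeffMatrix_of_notMem h, mul_zero]
    · rfl

/-- A coefficient vector is singular iff its matrix has a left and a right kernel vector without
zero entries. -/
theorem mem_singularCoefficients_iff (hB : IsEdgeConfig B) (z : B → ℂ) :
    z ∈ singularCoefficients B ↔ ∃ (α : ι → ℂ) (β : κ → ℂ), (∀ i, α i ≠ 0) ∧ (∀ j, β j ≠ 0) ∧
      (coeffMatrix z).mulVec β = 0 ∧ (coeffMatrix z).vecMul α = 0 := by
  constructor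
  · rintro ⟨γ, h0, h⟩
    refine ⟨γ ∘ Sum.inl, γ ∘ Sum.inr, fun i => h0 _, fun j => h0 _, ?_, ?_⟩
    · ext i
      rw [← laurentPartial_inl hB, h, Pi.zero_apply]
    · ext j
      rw [← laurentPartial_inr hB, h, Pi.zero_apply]
  · rintro ⟨α, β, hα, hβ, h1, h2⟩
    refine ⟨Sum.elim α β, ?_, ?_⟩
    · rintro (i | j)
      exacts [hα i, hβ j]
    · rintro (i | j)
      · rw [laurentPartial_inl hB, Sum.elim_comp_inr, h1, Pi.zero_apply]
      · rw [laurentPartial_inr hB, Sum.elim_comp_inl, h2, Pi.zero_apply]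

end EdgeVector

/-! ## Minors of the generic matrix -/

section Minors

variable {ι κ : Type*} [LinearOrder ι] [LinearOrder κ] {B : Finset (ι ⊕ κ → ℤ)}
variable {n : Type*} [Fintype n] [DecidableEq n]

/-- The minor of the generic matrix with rows `f` and columns `g`. -/
noncomputable def genericMinor (B : Finset (ι ⊕ κ → ℤ)) (f : n → ι) (g : n → κ) :
    MvPolynomial B ℂ := ((genericMatrix B).submatrix f g).det

theorem eval_genericMinor (z : B → ℂ) (f : n → ι) (g : n → κ) :
    eval z (genericMinor B f g) = ((coeffMatrix z).submatrix f g).det := by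
  rw [genericMinor, RingHom.map_det, RingHom.mapMatrix_apply, map_eval_genericMatrix_submatrix]

open scoped Classical in
/-- The coefficient vector of the edges `f a`, `g (s a)` with `a ∈ T`. -/
noncomputable def matchingCoeff (B : Finset (ι ⊕ κ → ℤ)) (f : n → ι) (g : n → κ)
    (s : Equiv.Perm n) (T : Set n) : B → ℂ :=
  fun u => if ∃ a ∈ T, edgeVector (f a) (g (s a)) = u then 1 else 0

/-- Only the edge of the row `a` has to lie in `B`, so the lemma also serves for cofactors, where
one row is exempt. -/
theorem coeffMatrix_matchingCoeff {f : n → ι} {g : n → κ} (hf : f.Injective) (hg : g.Injective)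
    {s : Equiv.Perm n} {T : Set n} {a : n} (ha : edgeVector (f a) (g (s a)) ∈ B) (haT : a ∈ T)
    (b : n) : coeffMatrix (matchingCoeff B f g s T) (f a) (g b) = s.permMatrix ℂ a b := by
  rw [Equiv.Perm.permMatrix, PEquiv.toMatrix_apply, Equiv.toPEquiv_apply]
  by_cases h : s a = b
  · subst h
    rw [coeffMatrix_of_mem ha, matchingCoeff, if_pos ⟨a, haT, rfl⟩, if_pos (by simp)]
  · rw [if_neg (by simpa using h)]
    by_cases hm : edgeVector (f a) (g b) ∈ B
    · rw [coeffMatrix_of_mem hm, matchingCoeff, if_neg]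
      rintro ⟨c, -, hc⟩
      obtain ⟨h1, h2⟩ := edgeVector_inj.1 hc
      rw [hf h1] at h2
      exact h (hg h2)
    · rw [coeffMatrix_of_notMem hm]

omit [DecidableEq n] in
theorem coeffMatrix_matchingCoeff_of_notMem {f : n → ι} {g : n → κ} (hf : f.Injective)
    {s : Equiv.Perm n} {T : Set n} {a : n} (haT : a ∉ T) (j : κ) :
    coeffMatrix (matchingCoeff B f g s T) (f a) j = 0 := by
  by_cases hm : edgeVector (f a) j ∈ B
  · rw [coeffMatrix_of_mem hm, matchingCoeff, if_neg]
    rintro ⟨c, hcT, hc⟩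
    obtain ⟨h1, -⟩ := edgeVector_inj.1 hc
    rw [hf h1] at hcT
    exact haT hcT
  · rw [coeffMatrix_of_notMem hm]

theorem det_permMatrix_ne_zero (s : Equiv.Perm n) : (s.permMatrix ℂ).det ≠ 0 := by
  rw [Matrix.det_permutation]
  exact_mod_cast Units.ne_zero (Equiv.Perm.sign s)

/-- At the indicator vector of a perfect matching the submatrix is a permutation matrix. -/
theorem eval_matchingCoeff_genericMinor {f : n → ι} {g : n → κ} (hf : f.Injective)
    (hg : g.Injective) {s : Equiv.Perm n} (h : ∀ a, edgeVector (f a) (g (s a)) ∈ B) :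
    eval (matchingCoeff B f g s Set.univ) (genericMinor B f g) ≠ 0 := by
  have : (coeffMatrix (matchingCoeff B f g s Set.univ)).submatrix f g = s.permMatrix ℂ := by
    ext a b
    exact coeffMatrix_matchingCoeff hf hg (h a) (Set.mem_univ a) b
  rw [eval_genericMinor, this]
  exact det_permMatrix_ne_zero s

theorem genericMinor_ne_zero {f : n → ι} {g : n → κ} (hf : f.Injective) (hg : g.Injective)
    (h : ∀ a, edgeVector (f a) (g a) ∈ B) : genericMinor B f g ≠ 0 := by
  intro h0
  have := eval_matchingCoeff_genericMinor (s := 1) hf hg h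
  rw [h0, map_zero] at this
  exact this rfl

/-- The variable of an edge that belongs to a perfect matching occurs in the determinant. -/
theorem mem_vars_genericMinor {f : n → ι} {g : n → κ} (hf : f.Injective) (hg : g.Injective)
    {s : Equiv.Perm n} (h : ∀ a, edgeVector (f a) (g (s a)) ∈ B) (a : n) :
    (⟨_, h a⟩ : B) ∈ (genericMinor B f g).vars := by
  by_contra hmem
  refine eval_matchingCoeff_genericMinor hf hg h ?_
  -- If the variable did not occur, deleting its edge from the matching would not change the value;
  -- but the deletion makes the row `a` zero.
  have h1 : eval (matchingCoeff B f g s Set.univ) (genericMinor B f g) =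
      eval (matchingCoeff B f g s {a}ᶜ) (genericMinor B f g) := by
    refine eval_congr_of_notMem_vars hmem fun w hw => ?_
    rw [matchingCoeff, matchingCoeff]
    congr 1
    refine propext ⟨?_, ?_⟩
    · rintro ⟨c, -, hc⟩
      refine ⟨c, ?_, hc⟩
      rintro rfl
      exact hw (Subtype.ext hc.symm)
    · rintro ⟨c, -, hc⟩
      exact ⟨c, Set.mem_univ c, hc⟩
  rw [h1, eval_genericMinor]
  refine Matrix.det_eq_zero_of_row_eq_zero a fun b => ?_
  exact coeffMatrix_matchingCoeff_of_notMem hf (by simp) _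

/-- The cofactor is the determinant with row `a` replaced by a unit vector, so a matching of the
other rows gives a permutation matrix; the pair `(a, b)` need not be an edge. -/
theorem adjugate_genericMatrix_ne_zero {f : n → ι} {g : n → κ} (hf : f.Injective)
    (hg : g.Injective) {s : Equiv.Perm n} {a b : n} (hs : s a = b)
    (h : ∀ c, c ≠ a → edgeVector (f c) (g (s c)) ∈ B) :
    ((genericMatrix B).submatrix f g).adjugate b a ≠ 0 := by
  intro h0
  rw [Matrix.adjugate_apply] at h0
  have h1 := congrArg (eval (matchingCoeff B f g s Set.univ)) h0
  rw [RingHom.map_det, RingHom.mapMatrix_apply, Matrix.map_updateRow,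
    map_eval_genericMatrix_submatrix, map_zero] at h1
  refine det_permMatrix_ne_zero s ?_
  rw [← h1]
  congr 1
  ext c d
  by_cases hc : c = a
  · subst hc
    subst hs
    rw [Matrix.updateRow_self, Function.comp_apply, Equiv.Perm.permMatrix, PEquiv.toMatrix_apply,
      Equiv.toPEquiv_apply, Pi.single_apply]
    by_cases hd : d = s c
    · simp [hd]
    · simp [hd, Ne.symm hd]
  · rw [Matrix.updateRow_ne hc]
    exact (coeffMatrix_matchingCoeff hf hg (h c hc) (Set.mem_univ c) d).symm

theorem gradeHom_genericMatrix (v : ι ⊕ κ) (i : ι) (j : κ) :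
    gradeHom B v (genericMatrix B i j) =
      Polynomial.X ^ (edgeVector i j v).toNat * Polynomial.C (genericMatrix B i j) := by
  by_cases h : edgeVector i j ∈ B
  · rw [genericMatrix_of_mem h, gradeHom_X, mul_comm]
  · rw [genericMatrix_of_notMem h, map_zero, map_zero, mul_zero]

/-- Grading at a left vertex multiplies its row by `t`, and the determinant is linear in each row.
-/
theorem gradeHom_inl_genericMinor (i : ι) (f : n → ι) (g : n → κ) :
    gradeHom B (Sum.inl i) (genericMinor B f g) =
      (∏ a, Polynomial.X ^ (if i = f a then 1 else 0)) * Polynomial.C (genericMinor B f g) := by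
  rw [genericMinor, RingHom.map_det, RingHom.map_det, ← Matrix.det_mul_column]
  congr 1
  ext1 a b
  simp only [RingHom.mapMatrix_apply, Matrix.map_apply, Matrix.submatrix_apply,
    gradeHom_genericMatrix, edgeVector_inl, Matrix.of_apply]
  split_ifs <;> simp

theorem gradeHom_inr_genericMinor (j : κ) (f : n → ι) (g : n → κ) :
    gradeHom B (Sum.inr j) (genericMinor B f g) =
      (∏ a, Polynomial.X ^ (if j = g a then 1 else 0)) * Polynomial.C (genericMinor B f g) := by
  rw [genericMinor, RingHom.map_det, RingHom.map_det, ← Matrix.det_mul_row]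
  congr 1
  ext1 a b
  simp only [RingHom.mapMatrix_apply, Matrix.map_apply, Matrix.submatrix_apply,
    gradeHom_genericMatrix, edgeVector_inr, Matrix.of_apply]
  split_ifs <;> simp

theorem vertexDegree_inl_genericMinor_eq_zero {i : ι} {f : n → ι} (g : n → κ)
    (hi : ∀ a, f a ≠ i) : vertexDegree (Sum.inl i) (genericMinor B f g) = 0 := by
  rw [vertexDegree, gradeHom_inl_genericMinor, Finset.prod_eq_one, one_mul, Polynomial.natDegree_C]
  intro a _
  rw [if_neg (hi a).symm, pow_zero]

theorem vertexDegree_inr_genericMinor_eq_zero {j : κ} (f : n → ι) {g : n → κ}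
    (hj : ∀ a, g a ≠ j) : vertexDegree (Sum.inr j) (genericMinor B f g) = 0 := by
  rw [vertexDegree, gradeHom_inr_genericMinor, Finset.prod_eq_one, one_mul, Polynomial.natDegree_C]
  intro a _
  rw [if_neg (hj a).symm, pow_zero]

theorem vertexDegree_inl_genericMinor_eq_one {f : n → ι} {g : n → κ} (hf : f.Injective)
    (h0 : genericMinor B f g ≠ 0) (a : n) :
    vertexDegree (Sum.inl (f a)) (genericMinor B f g) = 1 := by
  rw [vertexDegree, gradeHom_inl_genericMinor, Finset.prod_eq_single a, if_pos rfl, pow_one,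
    mul_comm, Polynomial.natDegree_C_mul_X _ h0]
  · intro b _ hb
    rw [if_neg fun h => hb (hf h.symm), pow_zero]
  · simp

theorem vertexDegree_inr_genericMinor_eq_one {f : n → ι} {g : n → κ} (hg : g.Injective)
    (h0 : genericMinor B f g ≠ 0) (a : n) :
    vertexDegree (Sum.inr (g a)) (genericMinor B f g) = 1 := by
  rw [vertexDegree, gradeHom_inr_genericMinor, Finset.prod_eq_single a, if_pos rfl, pow_one,
    mul_comm, Polynomial.natDegree_C_mul_X _ h0]
  · intro b _ hb
    rw [if_neg fun h => hb (hg h.symm), pow_zero]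
  · simp

theorem vertexDegree_adjugate_eq_zero {f : n → ι} {g : n → κ} (hf : f.Injective) (a b : n) :
    vertexDegree (Sum.inl (f a)) (((genericMatrix B).submatrix f g).adjugate b a) = 0 := by
  have : gradeHom B (Sum.inl (f a)) (((genericMatrix B).submatrix f g).adjugate b a) =
      Polynomial.C (((genericMatrix B).submatrix f g).adjugate b a) := by
    rw [Matrix.adjugate_apply, RingHom.map_det, RingHom.map_det, RingHom.mapMatrix_apply,
      RingHom.mapMatrix_apply, Matrix.map_updateRow, Matrix.map_updateRow]
    congr 1
    ext1 c d
    by_cases hc : c = a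
    · subst hc
      rw [Matrix.updateRow_self, Matrix.updateRow_self, Function.comp_apply, Function.comp_apply,
        Pi.single_apply]
      split_ifs <;> simp
    · rw [Matrix.updateRow_ne hc, Matrix.updateRow_ne hc, Matrix.map_apply, Matrix.map_apply,
        Matrix.submatrix_apply, gradeHom_genericMatrix, edgeVector_inl,
        if_neg fun h => hc (hf h).symm]
      simp
  rw [vertexDegree, this, Polynomial.natDegree_C]

variable [Fintype ι] [Fintype κ]

/-- A minor whose rows have no entries outside its columns vanishes on the singular coefficient
vectors. -/
theorem eval_genericMinor_of_rows (hB : IsEdgeConfig B) [Nonempty n] {f : n → ι} {g : n → κ}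
    (hg : g.Injective) (h : ∀ a j, edgeVector (f a) j ∈ B → j ∈ Set.range g) (z : B → ℂ)
    (hz : z ∈ singularCoefficients B) : eval z (genericMinor B f g) = 0 := by
  obtain ⟨α, β, -, hβ, h1, -⟩ := (mem_singularCoefficients_iff hB z).1 hz
  rw [eval_genericMinor]
  -- The restriction of `β` stays in the kernel because these rows vanish outside the columns `g`;
  -- it is non-zero because no entry of `β` is.
  refine Matrix.exists_mulVec_eq_zero_iff.1 ⟨β ∘ g, fun h0 => ?_, ?_⟩
  · exact hβ _ (congrFun h0 (Classical.arbitrary n))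
  · ext a
    have h2 : ∑ j, coeffMatrix z (f a) j * β j = 0 := congrFun h1 (f a)
    change ∑ b, coeffMatrix z (f a) (g b) * β (g b) = 0
    rw [← h2]
    refine Finset.sum_of_injOn g hg.injOn (by simp) ?_ (by simp)
    intro j _ hj
    rw [coeffMatrix_of_notMem fun hm => hj ?_, zero_mul]
    simpa using h a j hm

theorem eval_genericMinor_of_columns (hB : IsEdgeConfig B) [Nonempty n] {f : n → ι} {g : n → κ}
    (hf : f.Injective) (h : ∀ i a, edgeVector i (g a) ∈ B → i ∈ Set.range f) (z : B → ℂ)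
    (hz : z ∈ singularCoefficients B) : eval z (genericMinor B f g) = 0 := by
  obtain ⟨α, β, hα, -, -, h1⟩ := (mem_singularCoefficients_iff hB z).1 hz
  rw [eval_genericMinor]
  refine Matrix.exists_vecMul_eq_zero_iff.1 ⟨α ∘ f, fun h0 => ?_, ?_⟩
  · exact hα _ (congrFun h0 (Classical.arbitrary n))
  · ext a
    have h2 : ∑ i, α i * coeffMatrix z i (g a) = 0 := congrFun h1 (g a)
    change ∑ b, α (f b) * coeffMatrix z (f b) (g a) = 0
    rw [← h2]
    refine Finset.sum_of_injOn f hf.injOn (by simp) ?_ (by simp)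
    intro i _ hi
    rw [coeffMatrix_of_notMem fun hm => hi ?_, mul_zero]
    simpa using h i a hm

end Minors

/-! ## Matchings -/

section Matchings

variable {ι κ : Type*}

open scoped Classical in
/-- Hall's theorem for the elements of a finite set. -/
theorem exists_injective_of_card_le [Fintype κ] (r : ι → κ → Prop) (I : Finset ι)
    (h : ∀ W ⊆ I, W.card ≤ (Finset.univ.filter fun b => ∃ a ∈ W, r a b).card) :
    ∃ f : I → κ, f.Injective ∧ ∀ x : I, r x (f x) := by
  refine (Fintype.all_card_le_filter_rel_iff_exists_injective fun (x : I) b => r x b).1 fun A => ?_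
  have h1 := h (A.map (Function.Embedding.subtype _)) fun x hx => by
    obtain ⟨y, -, rfl⟩ := Finset.mem_map.1 hx
    exact y.2
  rw [Finset.card_map] at h1
  refine h1.trans (Finset.card_le_card fun b hb => ?_)
  simp only [Finset.mem_filter, Finset.mem_univ, true_and, Finset.mem_map,
    Function.Embedding.subtype_apply] at hb ⊢
  obtain ⟨_, ⟨y, hy, rfl⟩, hr⟩ := hb
  exact ⟨y, hy, hr⟩

open scoped Classical in
/-- If Hall's condition fails, then for a minimal violator `W` with neighborhood `N` the set `N`
can be matched into `W` avoiding any given element. -/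
theorem exists_matchings_of_card_lt [Fintype κ] (r : ι → κ → Prop) (I : Finset ι)
    (hI : ∀ i ∈ I, ∃ j, r i j)
    (h : ∃ W ⊆ I, (Finset.univ.filter fun b => ∃ a ∈ W, r a b).card < W.card) :
    ∃ (W : Finset ι) (N : Finset κ), N.Nonempty ∧ (∀ a ∈ W, ∀ b, r a b → b ∈ N) ∧
      ∀ i, ∃ f : N → ι, f.Injective ∧ ∀ b : N, f b ∈ W ∧ f b ≠ i ∧ r (f b) b := by
  obtain ⟨W, hW⟩ : ∃ W, Minimal (fun W : Finset ι => W ⊆ I ∧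
      (Finset.univ.filter fun b => ∃ a ∈ W, r a b).card < W.card) W :=
    exists_minimal_of_wellFoundedLT _ h
  obtain ⟨⟨hWI, hlt⟩, hmin⟩ := hW
  have hne : W.Nonempty := Finset.card_pos.1 (by omega)
  set N : Finset κ := Finset.univ.filter fun b => ∃ a ∈ W, r a b with hN
  have hWN : ∀ a ∈ W, ∀ b, r a b → b ∈ N := fun a ha b hab =>
    Finset.mem_filter.2 ⟨Finset.mem_univ _, a, ha, hab⟩
  have key : ∀ w ∈ W, ∃ f : N → ι, f.Injective ∧ ∀ b : N, f b ∈ W ∧ f b ≠ w ∧ r (f b) b := by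
    intro w hw
    -- By minimality no subset of `W.erase w` violates Hall's condition.
    obtain ⟨h, hinj, hr⟩ := exists_injective_of_card_le r (W.erase w) fun U hU => by
      by_contra! hcon
      have hUW : U ⊆ W := hU.trans (Finset.erase_subset _ _)
      have := hmin ⟨hUW.trans hWI, hcon⟩ hUW
      exact Finset.notMem_erase w W (hU (this hw))
    let h' : W.erase w → N := fun x => ⟨h x, hWN x (Finset.mem_of_mem_erase x.2) _ (hr x)⟩
    have hinj' : h'.Injective := fun x y hxy => hinj (congrArg Subtype.val hxy)
    -- `W.erase w` injects into `N` and `N` is smaller than `W`, so both have `W.card - 1` elements;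
    -- the inverse is the matching sought.
    have hbij : h'.Bijective := by
      refine (Fintype.bijective_iff_injective_and_card h').2 ⟨hinj', ?_⟩
      have := Fintype.card_le_of_injective h' hinj'
      simp only [Fintype.card_coe] at this ⊢
      rw [Finset.card_erase_of_mem hw] at this ⊢
      omega
    let e := Equiv.ofBijective h' hbij
    refine ⟨fun b => e.symm b, fun x y hxy => e.symm.injective (Subtype.ext hxy), fun b => ?_⟩
    refine ⟨Finset.mem_of_mem_erase (e.symm b).2, Finset.ne_of_mem_erase (e.symm b).2, ?_⟩
    have h1 := hr (e.symm b)
    have h2 : h (e.symm b) = b := congrArg Subtype.val (e.apply_symm_apply b)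
    rwa [h2] at h1
  obtain ⟨w, hw⟩ := hne
  refine ⟨W, N, ?_, hWN, fun i => ?_⟩
  · obtain ⟨j, hj⟩ := hI w (hWI hw)
    exact ⟨j, hWN w hw j hj⟩
  · by_cases hi : i ∈ W
    · exact key i hi
    · obtain ⟨f, hf, h1⟩ := key w hw
      refine ⟨f, hf, fun b => ⟨(h1 b).1, ?_, (h1 b).2.2⟩⟩
      rintro rfl
      exact hi (h1 b).1

open scoped Classical in
/-- The bipartite graph `r` between `I` and `J` has no isolated vertices, `I` and `J` have the same
number of elements, and every non-empty proper subset of `I` has more neighbors than elements. -/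
structure StrongHall (r : ι → κ → Prop) (I : Finset ι) (J : Finset κ) : Prop where
  nonempty : I.Nonempty
  card_eq : I.card = J.card
  left : ∀ i ∈ I, ∃ j ∈ J, r i j
  right : ∀ j ∈ J, ∃ i ∈ I, r i j
  card_lt : ∀ W, W.Nonempty → W ⊂ I → W.card < (J.filter fun j => ∃ i ∈ W, r i j).card

/-- A graph with the strong Hall property is connected. -/
theorem StrongHall.exists_color {r : ι → κ → Prop} {I : Finset ι} {J : Finset κ}
    (h : StrongHall r I J) {γ : Type*} (c : ι → γ) (d : κ → γ)
    (hcd : ∀ i ∈ I, ∀ j ∈ J, r i j → c i = d j) :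
    ∃ x, (∀ i ∈ I, c i = x) ∧ ∀ j ∈ J, d j = x := by
  classical
  obtain ⟨i₀, hi₀⟩ := h.nonempty
  have hI : ∀ i ∈ I, c i = c i₀ := by
    by_contra! hcon
    obtain ⟨i₁, hi₁, hne⟩ := hcon
    -- If two colours occurred, this colour class and its complement in `I` would have disjoint
    -- neighborhoods, each larger than the set itself, together exceeding `J.card = I.card`.
    let W := I.filter fun i => c i = c i₀
    let W' := I.filter fun i => ¬ c i = c i₀
    have h1 := h.card_lt W ⟨i₀, by simp [W, hi₀]⟩
      (Finset.filter_ssubset.2 ⟨i₁, hi₁, hne⟩)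
    have h2 := h.card_lt W' ⟨i₁, by simp [W', hi₁, hne]⟩
      (Finset.filter_ssubset.2 ⟨i₀, hi₀, by simp⟩)
    have h3 : W.card + W'.card = I.card :=
      Finset.card_filter_add_card_filter_not _
    have h4 : Disjoint (J.filter fun j => ∃ i ∈ W, r i j)
        (J.filter fun j => ∃ i ∈ W', r i j) := by
      refine Finset.disjoint_left.2 fun j hj hj' => ?_
      obtain ⟨hjJ, i, hi, hr⟩ := Finset.mem_filter.1 hj
      obtain ⟨-, i', hi', hr'⟩ := Finset.mem_filter.1 hj'
      obtain ⟨hiI, hi⟩ := Finset.mem_filter.1 hi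
      obtain ⟨hiI', hi'⟩ := Finset.mem_filter.1 hi'
      exact hi' (by rw [hcd i' hiI' j hjJ hr', ← hcd i hiI j hjJ hr, hi])
    have h5 := Finset.card_le_card (Finset.union_subset
      (Finset.filter_subset (fun j => ∃ i ∈ W, r i j) J)
      (Finset.filter_subset (fun j => ∃ i ∈ W', r i j) J))
    rw [Finset.card_union_of_disjoint h4] at h5
    have := h.card_eq
    omega
  refine ⟨c i₀, hI, fun j hj => ?_⟩
  obtain ⟨i, hi, hr⟩ := h.right j hj
  rw [← hcd i hi j hj hr, hI i hi]

/-- With the strong Hall property there are matchings which contain a given pair and are otherwise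
contained in the graph. -/
theorem StrongHall.exists_perm {r : ι → κ → Prop} {I : Finset ι} {J : Finset κ}
    (h : StrongHall r I J) {n : Type*} [Finite n] {f : n → ι} {g : n → κ} (hf : f.Injective)
    (hfI : Set.range f = I) (hgJ : Set.range g = J) (a b : n) :
    ∃ s : Equiv.Perm n, s a = b ∧ ∀ c, c ≠ a → r (f c) (g (s c)) := by
  classical
  have := Fintype.ofFinite n
  obtain ⟨k, hk, hr⟩ := exists_injective_of_card_le (fun c d => r (f c) (g d) ∧ d ≠ b)
    -- Removing `b` costs at most one neighbor, which the strict inequality for the proper subset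
    -- `W` makes up for.
    (Finset.univ.erase a) fun W hW => by
      rcases W.eq_empty_or_nonempty with rfl | hne
      · simp
      have ha : a ∉ W := fun haW => Finset.notMem_erase a _ (hW haW)
      have h1 := h.card_lt (W.image f) (hne.image f) (by
        refine Finset.ssubset_iff_of_subset ?_ |>.2 ⟨f a, ?_, ?_⟩
        · intro i hi
          obtain ⟨c, -, rfl⟩ := Finset.mem_image.1 hi
          exact Finset.mem_coe.1 (hfI ▸ Set.mem_range_self c)
        · exact Finset.mem_coe.1 (hfI ▸ Set.mem_range_self a)
        · intro hi
          obtain ⟨c, hc, hca⟩ := Finset.mem_image.1 hi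
          exact ha (hf hca ▸ hc))
      rw [Finset.card_image_of_injective _ hf] at h1
      have h2 : (J.filter fun j => ∃ i ∈ W.image f, r i j) ⊆
          (insert b (Finset.univ.filter fun d => ∃ c ∈ W, r (f c) (g d) ∧ d ≠ b)).image g := by
        intro j hj
        obtain ⟨hjJ, i, hi, hij⟩ := Finset.mem_filter.1 hj
        obtain ⟨c, hc, rfl⟩ := Finset.mem_image.1 hi
        obtain ⟨d, rfl⟩ : j ∈ Set.range g := hgJ ▸ Finset.mem_coe.2 hjJ
        refine Finset.mem_image_of_mem g ?_
        by_cases hd : d = b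
        · exact hd ▸ Finset.mem_insert_self _ _
        · exact Finset.mem_insert_of_mem
            (Finset.mem_filter.2 ⟨Finset.mem_univ _, c, hc, hij, hd⟩)
      have h3 := ((Finset.card_le_card h2).trans Finset.card_image_le).trans
        (Finset.card_insert_le _ _)
      convert Nat.lt_succ_iff.1 (h1.trans_le h3)
  let s : n → n := fun c => if hc : c = a then b else k ⟨c, by simp [hc]⟩
  have hsa : s a = b := dif_pos rfl
  have hs : ∀ c (hc : c ≠ a), s c = k ⟨c, by simp [hc]⟩ := fun c hc => dif_neg hc
  have hinj : s.Injective := by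
    intro c d hcd
    by_cases hc : c = a <;> by_cases hd : d = a
    · rw [hc, hd]
    · rw [hc, hsa, hs d hd] at hcd
      exact absurd hcd.symm (hr _).2
    · rw [hd, hsa, hs c hc] at hcd
      exact absurd hcd (hr _).2
    · rw [hs c hc, hs d hd] at hcd
      exact congrArg Subtype.val (hk hcd)
  refine ⟨Equiv.ofBijective s (Finite.injective_iff_bijective.1 hinj), hsa, fun c hc => ?_⟩
  rw [Equiv.ofBijective_apply, hs c hc]
  exact (hr ⟨c, by simp [hc]⟩).1

theorem StrongHall.exists_perm_of_edge {r : ι → κ → Prop} {I : Finset ι} {J : Finset κ}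
    (h : StrongHall r I J) {n : Type*} [Finite n] {f : n → ι} {g : n → κ} (hf : f.Injective)
    (hfI : Set.range f = I) (hgJ : Set.range g = J) {a b : n}
    (hab : r (f a) (g b)) : ∃ s : Equiv.Perm n, s a = b ∧ ∀ c, r (f c) (g (s c)) := by
  obtain ⟨s, hs, hr⟩ := h.exists_perm hf hfI hgJ a b
  refine ⟨s, hs, fun c => ?_⟩
  by_cases hc : c = a
  · rw [hc, hs]
    exact hab
  · exact hr c hc

end Matchings

/-! ## Non-defective configurations of edge vectors -/

section NonDefective

variable {ι κ : Type*} [LinearOrder ι] [LinearOrder κ] {B : Finset (ι ⊕ κ → ℤ)}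

/-- `e_i + e_j` belongs to `B`. -/
def EdgeRel (B : Finset (ι ⊕ κ → ℤ)) (i : ι) (j : κ) : Prop := edgeVector i j ∈ B

theorem isUnit_of_vertexDegree_inl (hB : IsEdgeConfig B) {p : MvPolynomial B ℂ} (hp : p ≠ 0)
    (h : ∀ i, vertexDegree (Sum.inl i) p = 0) : IsUnit p := by
  refine isUnit_of_vars_eq_empty hp fun u => ?_
  obtain ⟨i, j, hij⟩ := hB u u.2
  exact notMem_vars_of_vertexDegree_eq_zero (h i) (by simp [← hij])

theorem isUnit_of_vertexDegree_inr (hB : IsEdgeConfig B) {p : MvPolynomial B ℂ} (hp : p ≠ 0)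
    (h : ∀ j, vertexDegree (Sum.inr j) p = 0) : IsUnit p := by
  refine isUnit_of_vars_eq_empty hp fun u => ?_
  obtain ⟨i, j, hij⟩ := hB u u.2
  exact notMem_vars_of_vertexDegree_eq_zero (h j) (by simp [← hij])

variable [Fintype ι] [Fintype κ]

open scoped Classical in
/-- The left vertices of the edges in `B`. -/
noncomputable def leftVertices (B : Finset (ι ⊕ κ → ℤ)) : Finset ι :=
  Finset.univ.filter fun i => ∃ j, EdgeRel B i j

open scoped Classical in
/-- The right vertices of the edges in `B`. -/
noncomputable def rightVertices (B : Finset (ι ⊕ κ → ℤ)) : Finset κ :=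
  Finset.univ.filter fun j => ∃ i, EdgeRel B i j

omit [LinearOrder ι] [LinearOrder κ] [Fintype κ] in
theorem not_isNonDefective_empty [Fintype κ] : ¬ IsNonDefective (∅ : Finset (ι ⊕ κ → ℤ)) := by
  rintro ⟨p, hp⟩
  exact hp.2.1 (isUnit_of_vars_eq_empty hp.1.ne_zero fun u => absurd u.2 (Finset.notMem_empty _))

/-- As `p` divides each `q`, it has degree zero in every row; every variable belongs to a row, so
`p` would be constant. -/
theorem IsReducedEquation.isUnit_of_dvd_minors (hB : IsEdgeConfig B) {p : MvPolynomial B ℂ}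
    (hp : IsReducedEquation (discriminantVariety B) p)
    (h : ∀ i, ∃ q, q ≠ 0 ∧ vertexDegree (Sum.inl i) q = 0 ∧
      ∀ z ∈ singularCoefficients B, eval z q = 0) : False := by
  refine hp.2.1 (isUnit_of_vertexDegree_inl hB hp.1.ne_zero fun i => ?_)
  obtain ⟨q, hq0, hq, hz⟩ := h i
  have := vertexDegree_le_of_dvd (Sum.inl i) hq0 (hp.dvd_of_vanishes hz)
  omega

open scoped Classical in
theorem IsReducedEquation.card_le_left (hB : IsEdgeConfig B) {p : MvPolynomial B ℂ}
    (hp : IsReducedEquation (discriminantVariety B) p) (W : Finset ι) (hW : W ⊆ leftVertices B) :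
    W.card ≤ (Finset.univ.filter fun j => ∃ i ∈ W, EdgeRel B i j).card := by
  by_contra! hcon
  obtain ⟨W, N, hN, hWN, hf⟩ := exists_matchings_of_card_lt (EdgeRel B) (leftVertices B)
    (fun i hi => (Finset.mem_filter.1 hi).2) ⟨W, hW, hcon⟩
  have : Nonempty N := hN.to_subtype
  refine hp.isUnit_of_dvd_minors hB fun i => ?_
  obtain ⟨f, hinj, h1⟩ := hf i
  refine ⟨genericMinor B f Subtype.val,
    genericMinor_ne_zero hinj Subtype.val_injective fun b => (h1 b).2.2,
    vertexDegree_inl_genericMinor_eq_zero _ fun b => (h1 b).2.1,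
    eval_genericMinor_of_rows hB Subtype.val_injective fun b j hj => ?_⟩
  exact ⟨⟨j, hWN _ (h1 b).1 j hj⟩, rfl⟩

open scoped Classical in
-- The transposed argument: the minors now avoid a given column and vanish because of the left
-- kernel vector.
theorem IsReducedEquation.card_le_right (hB : IsEdgeConfig B) {p : MvPolynomial B ℂ}
    (hp : IsReducedEquation (discriminantVariety B) p) (W : Finset κ) (hW : W ⊆ rightVertices B) :
    W.card ≤ (Finset.univ.filter fun i => ∃ j ∈ W, EdgeRel B i j).card := by
  by_contra! hcon
  obtain ⟨W, N, hN, hWN, hf⟩ := exists_matchings_of_card_lt (fun j i => EdgeRel B i j)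
    (rightVertices B) (fun i hi => (Finset.mem_filter.1 hi).2) ⟨W, hW, hcon⟩
  have : Nonempty N := hN.to_subtype
  refine hp.2.1 (isUnit_of_vertexDegree_inr hB hp.1.ne_zero fun j => ?_)
  obtain ⟨f, hinj, h1⟩ := hf j
  have h2 : p ∣ genericMinor B Subtype.val f := by
    refine hp.dvd_of_vanishes
      (eval_genericMinor_of_columns hB Subtype.val_injective fun i b hi => ?_)
    exact ⟨⟨i, hWN _ (h1 b).1 i hi⟩, rfl⟩
  have h3 := vertexDegree_le_of_dvd (Sum.inr j)
    (genericMinor_ne_zero Subtype.val_injective hinj fun b => (h1 b).2.2) h2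
  rw [vertexDegree_inr_genericMinor_eq_zero _ fun b => (h1 b).2.1] at h3
  omega

/-- The graph of a non-defective configuration has the strong Hall property. -/
theorem IsReducedEquation.strongHall (hB : IsEdgeConfig B) {p : MvPolynomial B ℂ}
    (hp : IsReducedEquation (discriminantVariety B) p) :
    StrongHall (EdgeRel B) (leftVertices B) (rightVertices B) := by
  classical
  have hl : ∀ {i j}, EdgeRel B i j → i ∈ leftVertices B := fun h =>
    Finset.mem_filter.2 ⟨Finset.mem_univ _, _, h⟩
  have hr : ∀ {i j}, EdgeRel B i j → j ∈ rightVertices B := fun h =>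
    Finset.mem_filter.2 ⟨Finset.mem_univ _, _, h⟩
  have hcard : (leftVertices B).card = (rightVertices B).card := by
    refine le_antisymm ((hp.card_le_left hB _ subset_rfl).trans (Finset.card_le_card ?_))
      ((hp.card_le_right hB _ subset_rfl).trans (Finset.card_le_card ?_))
    · intro j hj
      obtain ⟨-, i, -, h⟩ := Finset.mem_filter.1 hj
      exact hr h
    · intro i hi
      obtain ⟨-, j, -, h⟩ := Finset.mem_filter.1 hi
      exact hl h
  refine ⟨?_, hcard, ?_, ?_, ?_⟩
  · rcases B.eq_empty_or_nonempty with rfl | ⟨u, hu⟩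
    · exact absurd ⟨p, hp⟩ not_isNonDefective_empty
    · obtain ⟨i, j, rfl⟩ := hB u hu
      exact ⟨i, hl (j := j) hu⟩
  · intro i hi
    obtain ⟨-, j, h⟩ := Finset.mem_filter.1 hi
    exact ⟨j, hr h, h⟩
  · intro j hj
    obtain ⟨-, i, h⟩ := Finset.mem_filter.1 hj
    exact ⟨i, hl h, h⟩
  intro W hne hW
  by_contra! hcon
  -- A perfect matching `h`. As `W` has at most `W.card` neighbors, these are exactly its partners,
  -- so the matrix is block triangular.
  obtain ⟨h, hinj, hrel⟩ := exists_injective_of_card_le (EdgeRel B) (leftVertices B)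
    fun U hU => by convert hp.card_le_left hB U hU
  let k : W → leftVertices B := fun x => ⟨x, hW.1 x.2⟩
  have hk : k.Injective := fun x y hxy => by simpa [k] using hxy
  let k' : (leftVertices B \ W : Finset ι) → leftVertices B :=
    fun x => ⟨x, Finset.sdiff_subset x.2⟩
  have hk' : k'.Injective := fun x y hxy => Subtype.ext <| by
    have h1 : (k' x : ι) = k' y := by rw [hxy]
    exact h1
  have himage : (Finset.univ.image (h ∘ k)) =
      (rightVertices B).filter fun j => ∃ i ∈ W, EdgeRel B i j := by
    refine Finset.eq_of_subset_of_card_le ?_ ?_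
    · intro j hj
      obtain ⟨x, -, rfl⟩ := Finset.mem_image.1 hj
      exact Finset.mem_filter.2 ⟨hr (hrel (k x)), x, x.2, hrel (k x)⟩
    · rw [Finset.card_image_of_injective _ (hinj.comp hk), Finset.card_univ, Fintype.card_coe]
      convert hcon
  have hmem : ∀ i ∈ W, ∀ j, EdgeRel B i j → ∃ x : W, h (k x) = j := by
    intro i hi j hij
    have : j ∈ Finset.univ.image (h ∘ k) :=
      himage ▸ Finset.mem_filter.2 ⟨hr hij, i, hi, hij⟩
    obtain ⟨x, -, hx⟩ := Finset.mem_image.1 this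
    exact ⟨x, hx⟩
  have : Nonempty W := hne.to_subtype
  have : Nonempty (leftVertices B \ W : Finset ι) := by
    obtain ⟨i, hi, hiW⟩ := Finset.exists_of_ssubset hW
    exact ⟨⟨i, Finset.mem_sdiff.2 ⟨hi, hiW⟩⟩⟩
  refine hp.isUnit_of_dvd_minors hB fun i => ?_
  -- Both diagonal blocks give minors vanishing on the singular vectors: the block of `W` contains
  -- all entries of its rows, the complementary block all entries of its columns. The block without
  -- row `i` is chosen.
  by_cases hi : i ∈ W
  · refine ⟨genericMinor B Subtype.val (h ∘ k'),
      genericMinor_ne_zero Subtype.val_injective (hinj.comp hk') fun x => hrel (k' x),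
      vertexDegree_inl_genericMinor_eq_zero _ ?_,
      eval_genericMinor_of_columns hB Subtype.val_injective ?_⟩
    · rintro x rfl
      exact (Finset.mem_sdiff.1 x.2).2 hi
    · intro i' x hx
      refine ⟨⟨i', Finset.mem_sdiff.2 ⟨hl hx, fun hi' => ?_⟩⟩, rfl⟩
      obtain ⟨y, hy⟩ := hmem i' hi' _ hx
      have hyx : (y : ι) = x := Subtype.ext_iff.1 (hinj hy)
      exact (Finset.mem_sdiff.1 x.2).2 (hyx ▸ y.2)
  · refine ⟨genericMinor B Subtype.val (h ∘ k),
      genericMinor_ne_zero Subtype.val_injective (hinj.comp hk) fun x => hrel (k x),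
      vertexDegree_inl_genericMinor_eq_zero _ ?_,
      eval_genericMinor_of_rows hB (hinj.comp hk) ?_⟩
    · rintro x rfl
      exact hi x.2
    · intro x j hj
      exact hmem x x.2 j hj

variable {I : Finset ι} {J : Finset κ} {n : Type*} [Fintype n] [DecidableEq n] {f : n → ι}
  {g : n → κ}

omit [Fintype ι] [Fintype κ] in
theorem StrongHall.genericMinor_ne_zero [Nonempty n] (h : StrongHall (EdgeRel B) I J)
    (hf : f.Injective) (hg : g.Injective) (hfI : Set.range f = I) (hgJ : Set.range g = J) :
    genericMinor B f g ≠ 0 := by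
  have a : n := Classical.arbitrary n
  obtain ⟨j, hj, haj⟩ := h.left (f a) (Finset.mem_coe.1 (hfI ▸ Set.mem_range_self a))
  obtain ⟨b, rfl⟩ : j ∈ Set.range g := hgJ ▸ Finset.mem_coe.2 hj
  obtain ⟨s, -, hs⟩ := h.exists_perm_of_edge hf hfI hgJ haj
  intro h0
  have := eval_matchingCoeff_genericMinor hf hg hs
  rw [h0, map_zero] at this
  exact this rfl

omit [Fintype ι] [Fintype κ] in
/-- With the strong Hall property the determinant of the generic matrix is irreducible. -/
theorem StrongHall.irreducible_genericMinor [Nonempty n] (hB : IsEdgeConfig B)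
    (h : StrongHall (EdgeRel B) I J) (hBI : ∀ i j, EdgeRel B i j → i ∈ I ∧ j ∈ J)
    (hf : f.Injective) (hg : g.Injective) (hfI : Set.range f = I) (hgJ : Set.range g = J) :
    Irreducible (genericMinor B f g) := by
  have hD := h.genericMinor_ne_zero hf hg hfI hgJ
  have hfdeg : ∀ i ∈ I, vertexDegree (Sum.inl i) (genericMinor B f g) = 1 := by
    intro i hi
    obtain ⟨a, rfl⟩ : i ∈ Set.range f := hfI ▸ Finset.mem_coe.2 hi
    exact vertexDegree_inl_genericMinor_eq_one hf hD a
  have hgdeg : ∀ j ∈ J, vertexDegree (Sum.inr j) (genericMinor B f g) = 1 := by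
    intro j hj
    obtain ⟨a, rfl⟩ : j ∈ Set.range g := hgJ ▸ Finset.mem_coe.2 hj
    exact vertexDegree_inr_genericMinor_eq_one hg hD a
  have hunit : ∀ p : MvPolynomial B ℂ, p ≠ 0 → (∀ i ∈ I, vertexDegree (Sum.inl i) p = 0) →
      IsUnit p := by
    refine fun p hp h0 => isUnit_of_vars_eq_empty hp fun u => ?_
    obtain ⟨i, j, hij⟩ := hB u u.2
    refine notMem_vars_of_vertexDegree_eq_zero (h0 i (hBI i j ?_).1) (by simp [← hij])
    rw [EdgeRel, hij]
    exact u.2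
  refine ⟨fun hu => ?_, fun p q hpq => ?_⟩
  · obtain ⟨i, hi⟩ := h.nonempty
    obtain ⟨r, hr⟩ := hu.exists_right_inv
    have h1 := vertexDegree_mul (Sum.inl i) hD (right_ne_zero_of_mul (hr ▸ one_ne_zero))
    rw [hr, hfdeg i hi, vertexDegree, map_one, Polynomial.natDegree_one] at h1
    omega
  · have hp : p ≠ 0 := left_ne_zero_of_mul (hpq ▸ hD)
    have hq : q ≠ 0 := right_ne_zero_of_mul (hpq ▸ hD)
    have hl : ∀ i ∈ I, vertexDegree (Sum.inl i) p + vertexDegree (Sum.inl i) q = 1 := by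
      intro i hi
      rw [← vertexDegree_mul _ hp hq, ← hpq, hfdeg i hi]
    have hr : ∀ j ∈ J, vertexDegree (Sum.inr j) p + vertexDegree (Sum.inr j) q = 1 := by
      intro j hj
      rw [← vertexDegree_mul _ hp hq, ← hpq, hgdeg j hj]
    -- Each vertex is coloured by the degree of `p` there, `0` or `1`. The variable of an edge
    -- occurs in `p` or in `q`, and that factor has degree one at both ends.
    obtain ⟨x, hx, -⟩ := h.exists_color (fun i => vertexDegree (Sum.inl i) p)
      (fun j => vertexDegree (Sum.inr j) p) (by
        intro i hi j hj hij
        classical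
        have hvar : (⟨_, hij⟩ : B) ∈ p.vars ∪ q.vars := by
          refine vars_mul p q ?_
          rw [← hpq]
          obtain ⟨a, rfl⟩ : i ∈ Set.range f := hfI ▸ Finset.mem_coe.2 hi
          obtain ⟨b, rfl⟩ : j ∈ Set.range g := hgJ ▸ Finset.mem_coe.2 hj
          obtain ⟨s, rfl, hs⟩ := h.exists_perm_of_edge hf hfI hgJ hij
          exact mem_vars_genericMinor hf hg hs a
        have h1 := hl i hi
        have h2 := hr j hj
        have h3 : ∀ p : MvPolynomial B ℂ, (⟨_, hij⟩ : B) ∈ p.vars →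
            vertexDegree (Sum.inl i) p ≠ 0 ∧ vertexDegree (Sum.inr j) p ≠ 0 := fun p hp =>
          ⟨fun h0 => notMem_vars_of_vertexDegree_eq_zero h0 (by simp) hp,
            fun h0 => notMem_vars_of_vertexDegree_eq_zero h0 (by simp) hp⟩
        rcases Finset.mem_union.1 hvar with hv | hv
        · have := h3 p hv
          omega
        · have := h3 q hv
          omega)
    by_cases h0 : x = 0
    · exact Or.inl (hunit p hp fun i hi => (hx i hi).trans h0)
    · refine Or.inr (hunit q hq fun i hi => ?_)
      have h1 := hl i hi
      have h2 := hx i hi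
      omega

/-- With the strong Hall property the determinant is an equation of the discriminant variety. -/
theorem StrongHall.isReducedEquation [Nonempty n] (hB : IsEdgeConfig B)
    (h : StrongHall (EdgeRel B) I J) (hBI : ∀ i j, EdgeRel B i j → i ∈ I ∧ j ∈ J)
    (hf : f.Injective) (hg : g.Injective) (hfI : Set.range f = I) (hgJ : Set.range g = J) :
    IsReducedEquation (discriminantVariety B) (genericMinor B f g) := by
  have hD := h.genericMinor_ne_zero hf hg hfI hgJ
  have hprime : Prime (genericMinor B f g) :=
    (h.irreducible_genericMinor hB hBI hf hg hfI hgJ).prime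
  set M := (genericMatrix B).submatrix f g with hM
  -- The determinant has degree one in the row `f a`, the non-zero cofactor degree zero.
  have hadj : ∀ a b, ¬ genericMinor B f g ∣ M.adjugate b a := by
    intro a b hdvd
    obtain ⟨s, hs, hr⟩ := h.exists_perm hf hfI hgJ a b
    have h1 := vertexDegree_le_of_dvd (Sum.inl (f a))
      (adjugate_genericMatrix_ne_zero hf hg hs hr) hdvd
    rw [vertexDegree_inl_genericMinor_eq_one hf hD, vertexDegree_adjugate_eq_zero hf] at h1
    omega
  refine isReducedEquation_of_prime hprime
    (eval_genericMinor_of_rows hB hg fun a j hj => hgJ ▸ (hBI _ j hj).2) fun q hq => ?_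
  -- Multiplying by all cofactors disposes of the points of `det = 0` where one of them vanishes;
  -- the primality of the determinant removes the factor again.
  have hmem : q * ∏ e : n × n, M.adjugate e.2 e.1 ∈
      vanishingIdeal ℂ (zeroLocus ℂ (Ideal.span {genericMinor B f g})) := by
    rw [mem_vanishingIdeal_iff]
    intro z hz
    have hz0 : eval z (genericMinor B f g) = 0 := by
      simpa [aeval_eq_eval] using hz _ (Ideal.mem_span_singleton_self _)
    rw [aeval_eq_eval, map_mul, map_prod, mul_eq_zero, Finset.prod_eq_zero_iff]
    by_contra! hcon
    obtain ⟨hqz, hne⟩ := hcon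
    refine hqz (hq z ((mem_singularCoefficients_iff hB z).2 ?_))
    set N := (coeffMatrix z).submatrix f g with hN
    have hNM : N.adjugate = M.adjugate.map (eval z) := by
      rw [hN, ← map_eval_genericMatrix_submatrix, ← RingHom.mapMatrix_apply,
        ← RingHom.map_adjugate, RingHom.mapMatrix_apply]
    have hNadj : ∀ a b, N.adjugate b a ≠ 0 := fun a b => by
      rw [hNM]
      exact hne (a, b) (Finset.mem_univ _)
    have hdet : N.det = 0 := by rw [← hz0, eval_genericMinor]
    have a₀ : n := Classical.arbitrary n
    have hrow : ∀ i, i ∉ Set.range f → ∀ j, coeffMatrix z i j = 0 := fun i hi j =>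
      coeffMatrix_of_notMem fun hm => hi (hfI ▸ (hBI i j hm).1)
    have hcol : ∀ j, j ∉ Set.range g → ∀ i, coeffMatrix z i j = 0 := fun j hj i =>
      coeffMatrix_of_notMem fun hm => hj (hgJ ▸ (hBI i j hm).2)
    -- A row and a column of the adjugate, which are kernel vectors because `det N = 0`. The value
    -- `1` elsewhere keeps the point in the torus and is harmless, since the matrix vanishes there.
    refine ⟨Function.extend f (fun a => N.adjugate a₀ a) 1,
      Function.extend g (fun b => N.adjugate b a₀) 1, fun i => ?_, fun j => ?_, ?_, ?_⟩
    · by_cases hi : ∃ a, f a = i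
      · obtain ⟨a, rfl⟩ := hi
        rw [hf.extend_apply]
        exact hNadj _ _
      · rw [Function.extend_apply' _ _ _ hi]
        exact one_ne_zero
    · by_cases hj : ∃ a, g a = j
      · obtain ⟨a, rfl⟩ := hj
        rw [hg.extend_apply]
        exact hNadj _ _
      · rw [Function.extend_apply' _ _ _ hj]
        exact one_ne_zero
    · ext i
      change ∑ j, coeffMatrix z i j * _ = 0
      by_cases hi : i ∈ Set.range f
      · obtain ⟨a, rfl⟩ := hi
        have h1 : (N * N.adjugate) a a₀ = 0 := by
          rw [Matrix.mul_adjugate, hdet, zero_smul, Matrix.zero_apply]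
        rw [Matrix.mul_apply] at h1
        rw [← h1]
        symm
        refine Finset.sum_of_injOn g hg.injOn (by simp) ?_ ?_
        · intro j _ hj
          rw [hcol j (by simpa using hj), zero_mul]
        · intro b _
          rw [hg.extend_apply]
          rfl
      · exact Finset.sum_eq_zero fun j _ => by rw [hrow i hi, zero_mul]
    · ext j
      change ∑ i, _ * coeffMatrix z i j = 0
      by_cases hj : j ∈ Set.range g
      · obtain ⟨b, rfl⟩ := hj
        have h1 : (N.adjugate * N) a₀ b = 0 := by
          rw [Matrix.adjugate_mul, hdet, zero_smul, Matrix.zero_apply]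
        rw [Matrix.mul_apply] at h1
        rw [← h1]
        symm
        refine Finset.sum_of_injOn f hf.injOn (by simp) ?_ ?_
        · intro i _ hi
          rw [hrow i (by simpa using hi), mul_zero]
        · intro a _
          rw [hf.extend_apply]
          rfl
      · exact Finset.sum_eq_zero fun i _ => by rw [hcol j hj, mul_zero]
  have hP : (Ideal.span {genericMinor B f g}).IsPrime :=
    (Ideal.span_singleton_prime hD).2 hprime
  rw [vanishingIdeal_zeroLocus_eq_radical, hP.radical, Ideal.mem_span_singleton] at hmem
  refine (hprime.dvd_or_dvd hmem).resolve_right fun hdvd => ?_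
  obtain ⟨e, -, he⟩ := hprime.exists_mem_finset_dvd hdvd
  exact hadj e.1 e.2 he

end NonDefective

/-! ## Faces of configurations -/

section Faces

variable {σ : Type*}

@[simp]
theorem latticeEmb_apply (u : σ → ℤ) (v : σ) : latticeEmb σ u v = (u v : ℝ) := rfl

theorem mem_configInter {A : Finset (σ → ℤ)} {Q : Set (σ → ℝ)} {u : σ → ℤ} :
    u ∈ configInter A Q ↔ u ∈ A ∧ latticeEmb σ u ∈ Q := by
  classical exact Finset.mem_filter

theorem latticeEmb_mem_configPolytope {A : Finset (σ → ℤ)} {u : σ → ℤ} (hu : u ∈ A) :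
    latticeEmb σ u ∈ configPolytope A :=
  subset_convexHull ℝ _ (Set.mem_image_of_mem _ hu)

/-- A face is the convex hull of the elements of the configuration which it contains. -/
theorem IsPolytopeFace.eq_convexHull [Fintype σ] {A : Finset (σ → ℤ)} {Q : Set (σ → ℝ)}
    (hQ : IsPolytopeFace (configPolytope A) Q) :
    Q = convexHull ℝ (latticeEmb σ '' (configInter A Q : Set (σ → ℤ))) := by
  have hP : IsCompact (configPolytope A) := (A.finite_toSet.image _).isCompact_convexHull ℝ
  have hexp : IsExposed ℝ (configPolytope A) Q := by
    obtain ⟨l, hl⟩ := hQ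
    exact fun _ => ⟨LinearMap.toContinuousLinearMap l, by simpa using hl⟩
  have hconv : Convex ℝ Q := hexp.convex (convex_convexHull ℝ _)
  refine Set.Subset.antisymm ?_ (convexHull_min ?_ hconv)
  · have hclosed : IsClosed (convexHull ℝ (latticeEmb σ '' (configInter A Q : Set (σ → ℤ)))) :=
      (((configInter A Q).finite_toSet.image _).isCompact_convexHull ℝ).isClosed
    calc Q = closure (convexHull ℝ (Set.extremePoints ℝ Q)) :=
          (closure_convexHull_extremePoints (hexp.isCompact hP) hconv).symm
      _ ⊆ _ := hclosed.closure_subset_iff.2 (convexHull_mono fun x hx => ?_)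
    obtain ⟨u, hu, rfl⟩ := extremePoints_convexHull_subset
      (hexp.isExtreme.extremePoints_subset_extremePoints hx)
    exact ⟨u, mem_configInter.2 ⟨hu, hx.1⟩, rfl⟩
  · rintro _ ⟨u, hu, rfl⟩
    exact (mem_configInter.1 hu).2

theorem IsNonDefective.isReducedEquation [Fintype σ] {A : Finset (σ → ℤ)}
    (h : IsNonDefective A) : IsReducedEquation (discriminantVariety A) (aDiscriminant A) := by
  rw [aDiscriminant, dif_pos h]
  exact h.choose_spec

end Faces

/-! ## Faces of edge polytopes -/

section EdgePolytope

variable {ι κ : Type*} [Fintype ι] [Fintype κ] [LinearOrder ι] [LinearOrder κ]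
  {G : SimpleGraph (ι ⊕ κ)} {I : Finset ι} {J : Finset κ}

theorem mem_edgeConfig {u : ι ⊕ κ → ℤ} :
    u ∈ edgeConfig G ↔ ∃ i j, G.Adj (Sum.inl i) (Sum.inr j) ∧ edgeVector i j = u := by
  classical
  simp [edgeConfig]

theorem edgeVector_mem_edgeConfig_iff {i : ι} {j : κ} :
    edgeVector i j ∈ edgeConfig G ↔ G.Adj (Sum.inl i) (Sum.inr j) := by
  refine ⟨fun h => ?_, edgeVector_mem_edgeConfig⟩
  obtain ⟨i', j', h1, h2⟩ := mem_edgeConfig.1 h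
  obtain ⟨rfl, rfl⟩ := edgeVector_inj.1 h2
  exact h1

theorem isEdgeConfig_configInter (G : SimpleGraph (ι ⊕ κ)) (Q : Set (ι ⊕ κ → ℝ)) :
    IsEdgeConfig (configInter (edgeConfig G) Q) := by
  intro u hu
  obtain ⟨i, j, -, h⟩ := mem_edgeConfig.1 (mem_configInter.1 hu).1
  exact ⟨i, j, h⟩

/-- The sum of the coordinates in `I` and `J`. -/
noncomputable def coordinateSum (I : Finset ι) (J : Finset κ) : (ι ⊕ κ → ℝ) →ₗ[ℝ] ℝ :=
  (∑ i ∈ I, LinearMap.proj (Sum.inl i)) + ∑ j ∈ J, LinearMap.proj (Sum.inr j)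

omit [Fintype ι] [Fintype κ] in
theorem coordinateSum_edgeVector (I : Finset ι) (J : Finset κ) (i : ι) (j : κ) :
    coordinateSum I J (latticeEmb _ (edgeVector i j)) =
      (if i ∈ I then 1 else 0) + (if j ∈ J then 1 else 0) := by
  simp [coordinateSum, LinearMap.sum_apply]

omit [Fintype ι] [Fintype κ] in
theorem coordinateSum_edgeVector_le (I : Finset ι) (J : Finset κ) (i : ι) (j : κ) :
    coordinateSum I J (latticeEmb _ (edgeVector i j)) ≤ 2 := by
  rw [coordinateSum_edgeVector]
  split_ifs <;> norm_num

omit [Fintype ι] [Fintype κ] in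
theorem two_le_coordinateSum_edgeVector {i : ι} {j : κ} :
    2 ≤ coordinateSum I J (latticeEmb _ (edgeVector i j)) ↔ i ∈ I ∧ j ∈ J := by
  rw [coordinateSum_edgeVector]
  split_ifs with h1 h2 h2 <;> norm_num [h1, h2]

omit [Fintype ι] [Fintype κ] in
theorem two_le_coordinateSum_of_mem_edgeFace {x : ι ⊕ κ → ℝ} (hx : x ∈ edgeFace G I J) :
    2 ≤ coordinateSum I J x := by
  refine convexHull_min ?_ (convex_halfSpace_ge (coordinateSum I J).isLinear 2) hx
  rintro _ ⟨i, hi, j, hj, -, rfl⟩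
  exact two_le_coordinateSum_edgeVector.2 ⟨hi, hj⟩

/-- `coordinateSum I J` is at least `2` on `Q_{I,J}`, while an edge vector reaches `2` only if both
ends lie in `I` and `J`. -/
theorem edgeVector_mem_configInter_edgeFace {i : ι} {j : κ} :
    EdgeRel (configInter (edgeConfig G) (edgeFace G I J)) i j ↔
      G.Adj (Sum.inl i) (Sum.inr j) ∧ i ∈ I ∧ j ∈ J := by
  rw [EdgeRel, mem_configInter, edgeVector_mem_edgeConfig_iff]
  refine and_congr_right fun h => ⟨fun h1 => ?_, fun h1 => ?_⟩
  · exact two_le_coordinateSum_edgeVector.1 (two_le_coordinateSum_of_mem_edgeFace h1)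
  · exact subset_convexHull ℝ _ ⟨i, h1.1, j, h1.2, h, rfl⟩

/-- The face is cut out by `coordinateSum I J`, bounded by `2` on the polytope; one edge inside is
needed for the bound to be attained. -/
theorem isPolytopeFace_edgeFace
    (h : ∃ i ∈ I, ∃ j ∈ J, G.Adj (Sum.inl i) (Sum.inr j)) :
    IsPolytopeFace (configPolytope (edgeConfig G)) (edgeFace G I J) := by
  obtain ⟨i₀, hi₀, j₀, hj₀, h₀⟩ := h
  refine ⟨coordinateSum I J, ?_⟩
  set Q := {x | x ∈ configPolytope (edgeConfig G) ∧
    ∀ y ∈ configPolytope (edgeConfig G), coordinateSum I J y ≤ coordinateSum I J x} with hQdef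
  have hQ : IsPolytopeFace (configPolytope (edgeConfig G)) Q := ⟨_, rfl⟩
  have hle : ∀ y ∈ configPolytope (edgeConfig G), coordinateSum I J y ≤ 2 := by
    refine fun y hy => convexHull_min ?_ (convex_halfSpace_le (coordinateSum I J).isLinear 2) hy
    rintro _ ⟨u, hu, rfl⟩
    obtain ⟨i, j, -, rfl⟩ := mem_edgeConfig.1 hu
    exact coordinateSum_edgeVector_le I J i j
  rw [hQ.eq_convexHull, edgeFace]
  congr 1
  ext x
  constructor
  · rintro ⟨i, hi, j, hj, h, rfl⟩
    have hu := edgeVector_mem_edgeConfig h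
    refine ⟨_, mem_configInter.2 ⟨hu, latticeEmb_mem_configPolytope hu, fun y hy => ?_⟩, rfl⟩
    exact (hle y hy).trans (two_le_coordinateSum_edgeVector.2 ⟨hi, hj⟩)
  · rintro ⟨u, hu, rfl⟩
    obtain ⟨huA, -, hmax⟩ := mem_configInter.1 hu
    obtain ⟨i, j, h, rfl⟩ := mem_edgeConfig.1 huA
    have h2 := (two_le_coordinateSum_edgeVector.2 ⟨hi₀, hj₀⟩).trans
      (hmax _ (latticeEmb_mem_configPolytope (edgeVector_mem_edgeConfig h₀)))
    obtain ⟨hi, hj⟩ := two_le_coordinateSum_edgeVector.1 h2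
    exact ⟨i, hi, j, hj, h, rfl⟩

/-- If the graph of a face has the strong Hall property, it is an induced subgraph. -/
theorem IsPolytopeFace.eq_edgeFace {Q : Set (ι ⊕ κ → ℝ)}
    (hQ : IsPolytopeFace (configPolytope (edgeConfig G)) Q)
    (h : StrongHall (EdgeRel (configInter (edgeConfig G) Q)) I J)
    (hIJ : ∀ i j, EdgeRel (configInter (edgeConfig G) Q) i j → i ∈ I ∧ j ∈ J) :
    Q = edgeFace G I J := by
  obtain ⟨l, hl⟩ := id hQ
  obtain ⟨i₀, hi₀⟩ := h.nonempty
  obtain ⟨j₀, -, h₀⟩ := h.left i₀ hi₀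
  set m := l (latticeEmb _ (edgeVector i₀ j₀)) with hm
  have hQ0 : latticeEmb _ (edgeVector i₀ j₀) ∈ Q := (mem_configInter.1 h₀).2
  have hconst : ∀ x ∈ Q, l x = m := by
    intro x hx
    rw [hl] at hx hQ0
    exact le_antisymm (hQ0.2 x hx.1) (hx.2 _ hQ0.1)
  have hadd : ∀ i j, l (latticeEmb _ (edgeVector i j)) =
      l (latticeEmb _ (Pi.single (Sum.inl i) 1)) + l (latticeEmb _ (Pi.single (Sum.inr j) 1)) := by
    intro i j
    rw [edgeVector, map_add, map_add]
  -- Along an edge of the face `l(e_i) + l(e_j) = m`, so `l(e_i)` and `m - l(e_j)` form a colouring.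
  -- Hence `l = m` on every edge between `I` and `J`.
  obtain ⟨x, hx, hy⟩ := h.exists_color
    (fun i : ι => l (latticeEmb (ι ⊕ κ) (Pi.single (Sum.inl i) 1)))
    (fun j : κ => m - l (latticeEmb (ι ⊕ κ) (Pi.single (Sum.inr j) 1))) (by
      intro i _ j _ hij
      have := hconst _ (mem_configInter.1 hij).2
      rw [hadd] at this
      linarith)
  have hinduced : ∀ i ∈ I, ∀ j ∈ J, G.Adj (Sum.inl i) (Sum.inr j) →
      edgeVector i j ∈ configInter (edgeConfig G) Q := by
    intro i hi j hj hij
    have hu := edgeVector_mem_edgeConfig hij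
    refine mem_configInter.2 ⟨hu, ?_⟩
    have h1 : l (latticeEmb _ (edgeVector i j)) = m := by
      have h2 := hx i hi
      have h3 := hy j hj
      rw [hadd]
      linarith
    rw [hl] at hQ0 ⊢
    exact ⟨latticeEmb_mem_configPolytope hu, fun y hy => h1 ▸ hQ0.2 y hy⟩
  refine hQ.eq_convexHull.trans ?_
  rw [edgeFace]
  congr 1
  ext y
  constructor
  · rintro ⟨u, hu, rfl⟩
    obtain ⟨i, j, h1, rfl⟩ := mem_edgeConfig.1 (mem_configInter.1 hu).1
    obtain ⟨hi, hj⟩ := hIJ i j hu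
    exact ⟨i, hi, j, hj, h1, rfl⟩
  · rintro ⟨i, hi, j, hj, h1, rfl⟩
    exact ⟨_, hinduced i hi j hj h1, rfl⟩

omit [LinearOrder ι] [LinearOrder κ] in
theorem mem_starPairs :
    (I, J) ∈ starPairs G ↔ I.Nonempty ∧ J.Nonempty ∧ I.card = J.card ∧
      IsConnectedOn G I J ∧ ConditionStar G I J := by
  classical simp [starPairs]

omit [Fintype ι] [Fintype κ] [LinearOrder ι] [LinearOrder κ] in
theorem StrongHall.isConnectedOn {r : ι → κ → Prop} (h : StrongHall r I J)
    (hr : ∀ i j, r i j → G.Adj (Sum.inl i) (Sum.inr j)) : IsConnectedOn G I J := by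
  obtain ⟨i₀, hi₀⟩ := h.nonempty
  set S : Set (ι ⊕ κ) := {v | Sum.elim (· ∈ I) (· ∈ J) v} with hS
  have hI : ∀ i ∈ I, Sum.inl i ∈ S := fun i hi => hi
  have hJ : ∀ j ∈ J, Sum.inr j ∈ S := fun j hj => hj
  let v₀ : S := ⟨Sum.inl i₀, hi₀⟩
  -- Reachability from `v₀` serves as the colour.
  let c : ι ⊕ κ → Prop := fun v => ∃ hv : v ∈ S, (G.induce S).Reachable v₀ ⟨v, hv⟩
  obtain ⟨x, hx, hy⟩ := h.exists_color (fun i => c (Sum.inl i)) (fun j => c (Sum.inr j)) (by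
    intro i hi j hj hij
    have hadj : (G.induce S).Adj ⟨Sum.inl i, hI i hi⟩ ⟨Sum.inr j, hJ j hj⟩ := hr i j hij
    refine propext ⟨?_, ?_⟩
    · rintro ⟨_, h1⟩
      exact ⟨hJ j hj, h1.trans hadj.reachable⟩
    · rintro ⟨_, h1⟩
      exact ⟨hI i hi, h1.trans hadj.symm.reachable⟩)
  have hxt : x := hx i₀ hi₀ ▸ ⟨hI i₀ hi₀, SimpleGraph.Reachable.refl _⟩
  refine (SimpleGraph.connected_iff_exists_forall_reachable _).2 ⟨v₀, ?_⟩
  rintro ⟨i | j, hv⟩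
  · obtain ⟨_, h1⟩ := (hx i hv).symm ▸ hxt
    exact h1
  · obtain ⟨_, h1⟩ := (hy j hv).symm ▸ hxt
    exact h1

omit [LinearOrder ι] [LinearOrder κ] in
theorem StrongHall.mem_starPairs {r : ι → κ → Prop} (h : StrongHall r I J)
    (hr : ∀ i j, r i j → G.Adj (Sum.inl i) (Sum.inr j)) : (I, J) ∈ starPairs G := by
  classical
  have hJ : J.Nonempty := by
    obtain ⟨i, hi⟩ := h.nonempty
    obtain ⟨j, hj, -⟩ := h.left i hi
    exact ⟨j, hj⟩
  have hconn := h.isConnectedOn hr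
  refine _root_.mem_starPairs.2 ⟨h.nonempty, hJ, h.card_eq, hconn, ?_⟩
  by_cases h1 : I.card = 1
  · exact Or.inl ⟨h1, hconn⟩
  · have := h.nonempty.card_pos
    refine Or.inr ⟨by omega, fun W hne hW => (h.card_lt W hne hW).trans_le ?_⟩
    refine Finset.card_le_card fun j hj => ?_
    obtain ⟨hjJ, i, hi, hij⟩ := Finset.mem_filter.1 hj
    exact Finset.mem_filter.2 ⟨hjJ, i, hi, hr i j hij⟩

/-- The pairs `(I, J)` with the property `(*)` have the strong Hall property. -/
theorem strongHall_of_mem_starPairs (hbip : G ≤ completeBipartiteGraph ι κ)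
    (h : (I, J) ∈ starPairs G) :
    StrongHall (EdgeRel (configInter (edgeConfig G) (edgeFace G I J))) I J := by
  classical
  obtain ⟨hI, hJ, hcard, hconn, hstar⟩ := mem_starPairs.1 h
  obtain ⟨i₀, hi₀⟩ := id hI
  obtain ⟨j₀, hj₀⟩ := id hJ
  set S : Set (ι ⊕ κ) := {v | Sum.elim (· ∈ I) (· ∈ J) v} with hS
  -- A connected graph with more than one vertex has no isolated vertices, and bipartiteness puts
  -- the neighbor on the other side.
  have : Nontrivial S := ⟨⟨Sum.inl i₀, hi₀⟩, ⟨Sum.inr j₀, hj₀⟩,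
    fun h => Sum.inl_ne_inr (congrArg Subtype.val h)⟩
  refine ⟨hI, hcard, fun i hi => ?_, fun j hj => ?_, fun W hne hW => ?_⟩
  · obtain ⟨⟨w, hw⟩, hadj⟩ := hconn.preconnected.exists_adj_of_nontrivial ⟨Sum.inl i, hi⟩
    have hadj' : G.Adj (Sum.inl i) w := hadj
    rcases w with i' | j
    · simpa using hbip hadj'
    · exact ⟨j, hw, edgeVector_mem_configInter_edgeFace.2 ⟨hadj', hi, hw⟩⟩
  · obtain ⟨⟨w, hw⟩, hadj⟩ := hconn.preconnected.exists_adj_of_nontrivial ⟨Sum.inr j, hj⟩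
    have hadj' : G.Adj (Sum.inr j) w := hadj
    rcases w with i | j'
    · exact ⟨i, hw, edgeVector_mem_configInter_edgeFace.2 ⟨hadj'.symm, hw, hj⟩⟩
    · simpa using hbip hadj'
  · rcases hstar with ⟨h1, -⟩ | ⟨-, h1⟩
    · have h2 := Finset.card_lt_card hW
      have h3 := hne.card_pos
      omega
    · refine (h1 W hne hW).trans_le (Finset.card_le_card fun j hj => ?_)
      obtain ⟨hjJ, i, hi, hij⟩ := Finset.mem_filter.1 hj
      exact Finset.mem_filter.2
        ⟨hjJ, i, hi, edgeVector_mem_configInter_edgeFace.2 ⟨hij, hW.1 hi, hjJ⟩⟩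

theorem leftVertices_edgeFace
    (h : StrongHall (EdgeRel (configInter (edgeConfig G) (edgeFace G I J))) I J) :
    leftVertices (configInter (edgeConfig G) (edgeFace G I J)) = I := by
  classical
  ext i
  refine ⟨fun hi => ?_, fun hi => ?_⟩
  · obtain ⟨-, j, hj⟩ := Finset.mem_filter.1 hi
    exact (edgeVector_mem_configInter_edgeFace.1 hj).2.1
  · obtain ⟨j, -, hj⟩ := h.left i hi
    exact Finset.mem_filter.2 ⟨Finset.mem_univ _, j, hj⟩

theorem rightVertices_edgeFace
    (h : StrongHall (EdgeRel (configInter (edgeConfig G) (edgeFace G I J))) I J) :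
    rightVertices (configInter (edgeConfig G) (edgeFace G I J)) = J := by
  classical
  ext j
  refine ⟨fun hj => ?_, fun hj => ?_⟩
  · obtain ⟨-, i, hi⟩ := Finset.mem_filter.1 hj
    exact (edgeVector_mem_configInter_edgeFace.1 hi).2.2
  · obtain ⟨i, -, hi⟩ := h.right j hj
    exact Finset.mem_filter.2 ⟨Finset.mem_univ _, i, hi⟩

/-- `I` and `J` are recovered from the face as the sets of ends of its edges. This allows the
product over faces to be taken over pairs. -/
theorem edgeFace_injOn (hbip : G ≤ completeBipartiteGraph ι κ) :
    Set.InjOn (fun p : Finset ι × Finset κ => edgeFace G p.1 p.2) (starPairs G) := by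
  rintro ⟨I, J⟩ hp ⟨I', J'⟩ hq h
  have h1 := strongHall_of_mem_starPairs hbip hp
  have h2 := strongHall_of_mem_starPairs hbip hq
  have h3 : edgeFace G I J = edgeFace G I' J' := h
  refine Prod.ext ?_ ?_
  · exact (leftVertices_edgeFace h1).symm.trans (h3 ▸ leftVertices_edgeFace h2)
  · exact (rightVertices_edgeFace h1).symm.trans (h3 ▸ rightVertices_edgeFace h2)

/-- The edge vectors of a connected bipartite graph generate a saturated lattice. -/
theorem faceIndex_edgeFace
    (h : StrongHall (EdgeRel (configInter (edgeConfig G) (edgeFace G I J))) I J) :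
    faceIndex (edgeConfig G) (edgeFace G I J) = 1 := by
  classical
  rw [faceIndex, AddSubgroup.relIndex_eq_one]
  intro x hx
  set T : Set (ι ⊕ κ → ℝ) := {x | ∃ i ∈ I, ∃ j ∈ J, G.Adj (Sum.inl i) (Sum.inr j) ∧
    x = latticeEmb (ι ⊕ κ) (edgeVector i j)}
  have hspan : latticeEmb _ x ∈ Submodule.span ℝ T := by
    have h1 : latticeEmb _ x ∈ Submodule.span ℝ (edgeFace G I J) := hx
    refine Submodule.span_le.2 ?_ h1
    exact convexHull_min Submodule.subset_span (Submodule.span ℝ T).convex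
  -- The real span is tested only by the coordinates outside `I` and `J` and by the difference of
  -- the two coordinate sums.
  have hker : ∀ l : (ι ⊕ κ → ℝ) →ₗ[ℝ] ℝ,
      (∀ i ∈ I, ∀ j ∈ J, l (latticeEmb _ (edgeVector i j)) = 0) → l (latticeEmb _ x) = 0 := by
    intro l hl
    have : Submodule.span ℝ T ≤ LinearMap.ker l := Submodule.span_le.2 (by
      rintro _ ⟨i, hi, j, hj, -, rfl⟩
      exact hl i hi j hj)
    exact this hspan
  have hxI : ∀ i, i ∉ I → x (Sum.inl i) = 0 := by
    intro i hi
    have := hker (LinearMap.proj (Sum.inl i)) fun i' hi' j _ => by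
      simp [show i ≠ i' from fun h => hi (h ▸ hi')]
    simpa using this
  have hxJ : ∀ j, j ∉ J → x (Sum.inr j) = 0 := by
    intro j hj
    have := hker (LinearMap.proj (Sum.inr j)) fun i _ j' hj' => by
      simp [show j ≠ j' from fun h => hj (h ▸ hj')]
    simpa using this
  have hsum : ∑ i ∈ I, x (Sum.inl i) = ∑ j ∈ J, x (Sum.inr j) := by
    have := hker ((∑ i ∈ I, LinearMap.proj (Sum.inl i)) - ∑ j ∈ J, LinearMap.proj (Sum.inr j))
      fun i hi j hj => by simp [LinearMap.sum_apply, hi, hj]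
    rw [LinearMap.sub_apply, LinearMap.sum_apply, LinearMap.sum_apply, sub_eq_zero] at this
    simp only [LinearMap.proj_apply, latticeEmb_apply] at this
    exact_mod_cast this
  set L := Submodule.span ℤ (configInter (edgeConfig G) (edgeFace G I J) : Set (ι ⊕ κ → ℤ))
  -- Modulo `L` each edge gives `e_i = -e_j`, so by connectedness all `e_i` have one class `m` and
  -- all `e_j` the class `-m`; the equal coordinate sums then cancel.
  obtain ⟨m, hm, hm'⟩ := h.exists_color (fun i : ι => L.mkQ (Pi.single (Sum.inl i) 1))
    (fun j : κ => - L.mkQ (Pi.single (Sum.inr j) 1)) (by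
      intro i _ j _ hij
      have h1 : L.mkQ (edgeVector i j) = 0 :=
        (Submodule.Quotient.mk_eq_zero L).2 (Submodule.subset_span hij)
      rw [edgeVector, map_add] at h1
      exact eq_neg_of_add_eq_zero_left h1)
  have hxsum : x = ∑ i ∈ I, x (Sum.inl i) • (Pi.single (Sum.inl i) 1 : ι ⊕ κ → ℤ) +
      ∑ j ∈ J, x (Sum.inr j) • (Pi.single (Sum.inr j) 1 : ι ⊕ κ → ℤ) := by
    ext (i | j)
    · by_cases hi : i ∈ I
      · simp [Finset.sum_apply, Pi.single_apply, hi]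
      · simp [Finset.sum_apply, Pi.single_apply, hi, hxI i hi]
    · by_cases hj : j ∈ J
      · simp [Finset.sum_apply, Pi.single_apply, hj]
      · simp [Finset.sum_apply, Pi.single_apply, hj, hxJ j hj]
  have h0 : L.mkQ x = 0 := by
    rw [hxsum, map_add, map_sum, map_sum]
    have h1 : ∀ i ∈ I, L.mkQ (x (Sum.inl i) • (Pi.single (Sum.inl i) 1 : ι ⊕ κ → ℤ)) =
        x (Sum.inl i) • m := fun i hi => by rw [map_smul]; exact congrArg _ (hm i hi)
    have h2 : ∀ j ∈ J, L.mkQ (x (Sum.inr j) • (Pi.single (Sum.inr j) 1 : ι ⊕ κ → ℤ)) =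
        -(x (Sum.inr j) • m) := fun j hj => by
      rw [map_smul, ← smul_neg]
      exact congrArg _ (neg_eq_iff_eq_neg.1 (hm' j hj))
    rw [Finset.sum_congr rfl h1, Finset.sum_congr rfl h2, Finset.sum_neg_distrib,
      ← Finset.sum_smul, ← Finset.sum_smul, hsum, add_neg_cancel]
  exact (Submodule.Quotient.mk_eq_zero L).1 h0

theorem isReducedEquation_edgeFace
    (h : StrongHall (EdgeRel (configInter (edgeConfig G) (edgeFace G I J))) I J) :
    IsReducedEquation (discriminantVariety (configInter (edgeConfig G) (edgeFace G I J)))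
      (genericMinor _ (I.orderEmbOfFin rfl) (J.orderEmbOfFin h.card_eq.symm)) := by
  have : NeZero I.card := ⟨h.nonempty.card_pos.ne'⟩
  exact h.isReducedEquation (isEdgeConfig_configInter G _)
    (fun i j hij => (edgeVector_mem_configInter_edgeFace.1 hij).2)
    (I.orderEmbOfFin rfl).injective (J.orderEmbOfFin _).injective
    (I.range_orderEmbOfFin rfl) (J.range_orderEmbOfFin _)

theorem rename_genericMinor_edgeFace (hcard : J.card = I.card) :
    rename (fun u : configInter (edgeConfig G) (edgeFace G I J) =>
        (⟨u, configInter_subset _ _ u.2⟩ : edgeConfig G))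
      (genericMinor _ (I.orderEmbOfFin rfl) (J.orderEmbOfFin hcard)) = edmondsMinor G I J := by
  rw [edmondsMinor, dif_pos hcard, genericMinor, AlgHom.map_det]
  congr 1
  ext1 a b
  have hi : I.orderEmbOfFin rfl a ∈ I := I.orderEmbOfFin_mem rfl a
  have hj : J.orderEmbOfFin hcard b ∈ J := J.orderEmbOfFin_mem hcard b
  simp only [AlgHom.mapMatrix_apply, Matrix.map_apply, Matrix.submatrix_apply]
  by_cases hadj : G.Adj (Sum.inl (I.orderEmbOfFin rfl a)) (Sum.inr (J.orderEmbOfFin hcard b))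
  · rw [genericMatrix_of_mem (edgeVector_mem_configInter_edgeFace.2 ⟨hadj, hi, hj⟩), rename_X,
      edmondsMatrix, dif_pos hadj]
  · rw [genericMatrix_of_notMem fun hm => hadj (edgeVector_mem_configInter_edgeFace.1 hm).1,
      map_zero, edmondsMatrix, dif_neg hadj]

theorem associated_faceDiscriminant_edmondsMinor
    (h : StrongHall (EdgeRel (configInter (edgeConfig G) (edgeFace G I J))) I J) :
    Associated (faceDiscriminant (edgeConfig G) (edgeFace G I J)) (edmondsMinor G I J) := by
  have h1 := isReducedEquation_edgeFace h
  have h2 : IsNonDefective (configInter (edgeConfig G) (edgeFace G I J)) := ⟨_, h1⟩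
  rw [faceDiscriminant, ← rename_genericMinor_edgeFace h.card_eq.symm]
  exact (h2.isReducedEquation.associated h1).map _

/-- A face with a non-defective configuration is of the form `Q_{I,J}`. -/
theorem IsNonDefective.exists_starPair {Q : Set (ι ⊕ κ → ℝ)}
    (hQ : IsPolytopeFace (configPolytope (edgeConfig G)) Q)
    (h : IsNonDefective (configInter (edgeConfig G) Q)) :
    ∃ p ∈ starPairs G, Q = edgeFace G p.1 p.2 := by
  classical
  obtain ⟨p, hp⟩ := h
  have hH := hp.strongHall (isEdgeConfig_configInter G Q)
  refine ⟨(_, _), hH.mem_starPairs fun i j hij => ?_, hQ.eq_edgeFace hH fun i j hij => ?_⟩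
  · exact edgeVector_mem_edgeConfig_iff.1 (mem_configInter.1 hij).1
  · exact ⟨Finset.mem_filter.2 ⟨Finset.mem_univ _, j, hij⟩,
      Finset.mem_filter.2 ⟨Finset.mem_univ _, i, hij⟩⟩

theorem filter_isNonDefective_eq_image [DecidableEq (Set (ι ⊕ κ → ℝ))]
    [DecidablePred fun Q => IsNonDefective (configInter (edgeConfig G) Q)]
    (hbip : G ≤ completeBipartiteGraph ι κ) :
    ((configFaces (edgeConfig G)).filter fun Q => IsNonDefective (configInter (edgeConfig G) Q)) =
      (starPairs G).image fun p => edgeFace G p.1 p.2 := by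
  ext Q
  rw [Finset.mem_filter, configFaces, Set.Finite.mem_toFinset, Set.mem_ofPred_eq, Finset.mem_image]
  constructor
  · rintro ⟨hQ, h⟩
    obtain ⟨p, hp, rfl⟩ := h.exists_starPair hQ
    exact ⟨p, hp, rfl⟩
  · rintro ⟨⟨I, J⟩, hp, rfl⟩
    have h := strongHall_of_mem_starPairs hbip hp
    refine ⟨isPolytopeFace_edgeFace ?_, _, isReducedEquation_edgeFace h⟩
    obtain ⟨i, hi⟩ := h.nonempty
    obtain ⟨j, hj, hij⟩ := h.left i hi
    exact ⟨i, hi, j, hj, (edgeVector_mem_configInter_edgeFace.1 hij).1⟩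

end EdgePolytope

theorem mainTheorem1 {ι κ : Type*} [Fintype ι] [Fintype κ] [LinearOrder ι] [LinearOrder κ]
    (G : SimpleGraph (ι ⊕ κ)) (hbip : G ≤ completeBipartiteGraph ι κ) (hconn : G.Connected) :
    Associated (principalADeterminant (edgeConfig G))
      (∏ p ∈ starPairs G, edmondsMinor G p.1 p.2 ^
        subdiagramVolume (semigroupQuotient (edgeConfig G) (edgeFace G p.1 p.2))) ∧
    ∀ Q : Set (ι ⊕ κ → ℝ), IsPolytopeFace (configPolytope (edgeConfig G)) Q →
      (¬ ∃ p ∈ starPairs G, Q = edgeFace G p.1 p.2) →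
      aDiscriminant (configInter (edgeConfig G) Q) = 1 := by
  classical
  refine ⟨?_, fun Q hQ hnot => ?_⟩
  · rw [principalADeterminant, filter_isNonDefective_eq_image hbip,
      Finset.prod_image (edgeFace_injOn hbip)]
    refine Associated.prod _ _ _ fun p hp => ?_
    have h := strongHall_of_mem_starPairs hbip hp
    rw [faceMultiplicity, faceIndex_edgeFace h, one_mul]
    exact (associated_faceDiscriminant_edmondsMinor h).pow_pow
  · rw [aDiscriminant, dif_neg fun h => hnot (h.exists_starPair hQ)]
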